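/- Let $\mathcal C$ be an additive braided tensor category with braiding $C$ and unit object $I$, whose tensor product is additive in each variable on morphisms; associativity and unit isomorphisms are suppressed. The braiding is called symmetric on a family $\mathcal E$ of objects if $C_{U,V}=(C_{V,U})^{-1}$ for all $U,V\in\mathcal E$ (including $U=V$). Composites are read from right to left, $\mathrm{id}$ is the identity of the evident object, $C_{12}=C_{L,L}\otimes\mathrm{id}_L$ and $C_{23}=\mathrm{id}_L\otimes C_{L,L}$. Definitions. Let $L$ be an object on which $C$ is symmetric. A bracket $[\,,]:L\otimes L\to L$ makes $L$ a braided Lie algebra if $[\,,](\mathrm{id}+C_{L,L})=0$ and $[\,,]([\,,]\otimes\mathrm{id})(\mathrm{id}+C_{12}C_{23}+C_{23}C_{12})=0$. A cobracket $\delta:L\to L\otimes L$ makes $L$ a braided Lie coalgebra if $(\mathrm{id}+C_{L,L})\delta=0$ and $(\mathrm{id}+C_{12}C_{23}+C_{23}C_{12})(\delta\otimes\mathrm{id})\delta=0$. Put $$\mathrm{Ad}_{L}=([\,,]\otimes\mathrm{id})(\mathrm{id}\otimes\delta)+(\mathrm{id}\otimes[\,,])(C_{L,L}\otimes\mathrm{id})(\mathrm{id}\otimes\delta):L\otimes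 L\to L\otimes L .$$ $(L,[\,,],\delta)$ is a braided Lie bialgebra if it is a braided Lie algebra, a braided Lie coalgebra, and $\delta[\,,]=\mathrm{Ad}_L(\mathrm{id}-C_{L,L})$. A quasitriangular braided Lie bialgebra $(H,R)$ is a braided Lie bialgebra $H$ with a morphism $R:I\to H\otimes H$ such that $$\delta=\big([\,,]\otimes\mathrm{id}+(\mathrm{id}\otimes[\,,])(C_{H,H}\otimes\mathrm{id})\big)(\mathrm{id}_H\otimes R)$$ and $$\big(([\,,]\otimes\mathrm{id}\otimes\mathrm{id})(\mathrm{id}\otimes C_{H,H}\otimes\mathrm{id})+(\mathrm{id}\otimes[\,,]\otimes\mathrm{id})+(\mathrm{id}\otimes\mathrm{id}\otimes[\,,])(\mathrm{id}\otimes C_{H,H}\otimes\mathrm{id})\big)(R\otimes R)=0 .$$ Let $A$, $H$ be objects such that $C$ is symmetric on $\{A,H\}$, let $H$ be a braided Lie algebra and $\alpha:H\otimes A\to A$ a morphism. $(A,\alpha)$ is a left $H$-module if $\alpha([\,,]_H\otimes\mathrm{id})=\alpha(\mathrm{id}\otimes\alpha)-\alpha(\mathrm{id}\otimes\alpha)(C_{H,H}\otimes\mathrm{id})$.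 It is an $H$-module braided Lie algebra if moreover $A$ is a braided Lie algebra and $\alpha(\mathrm{id}\otimes[\,,]_A)=[\,,]_A(\alpha\otimes\mathrm{id})+[\,,]_A(\mathrm{id}\otimes\alpha)(C_{H,A}\otimes\mathrm{id})$, and an $H$-module braided Lie coalgebra if it is a left $H$-module, $A$ is a braided Lie coalgebra and $\delta_A\alpha=(\alpha\otimes\mathrm{id})(\mathrm{id}\otimes\delta_A)+(\mathrm{id}\otimes\alpha)(C_{H,A}\otimes\mathrm{id})(\mathrm{id}\otimes\delta_A)$. For a morphism $\phi:A\to H\otimes A$, the infinitesimal braiding ${}^SC:A\otimes A\to A\otimes A$ is $$\begin{aligned}{}^SC={}&(\alpha\otimes\mathrm{id})(C_{A,H}\otimes\mathrm{id})(\mathrm{id}\otimes\phi)+(\mathrm{id}\otimes\alpha)(C_{H,A}\otimes\mathrm{id})(\phi\otimes\mathrm{id})\\&-(\alpha\otimes\mathrm{id})(\mathrm{id}\otimes C_{A,A})(\phi\otimes\mathrm{id})\\&-(\mathrm{id}\otimes\alpha)(C_{H,A}\otimes\mathrm{id})(\mathrm{id}\otimes C_{A,A})(C_{A,H}\otimes\mathrm{id})(\mathrm{id}\otimes\phi),\end{aligned}$$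 and (SLB) is the equation $\delta_A[\,,]_A=\mathrm{Ad}_A(\mathrm{id}-C_{A,A})-{}^SC$ on $A\otimes A$. The bisum determined by $\alpha$ and $\phi$ is the object $D=A\oplus H$, with projections $\pi_A,\pi_H$ and injections $\iota_A,\iota_H$, and with $$[\,,]_D=\iota_A\big([\,,]_A(\pi_A\otimes\pi_A)+\alpha(\pi_H\otimes\pi_A)-\alpha C_{A,H}(\pi_A\otimes\pi_H)\big)+\iota_H[\,,]_H(\pi_H\otimes\pi_H),$$ $$\delta_D=\big((\iota_A\otimes\iota_A)\delta_A+(\iota_H\otimes\iota_A)\phi-(\iota_A\otimes\iota_H)C_{H,A}\phi\big)\pi_A+(\iota_H\otimes\iota_H)\delta_H\pi_H .$$ Statement. Let $A$ and $H$ be objects of $\mathcal C$ such that $C$ is symmetric on $\{A,H\}$. Assume that $(H,R)$ is a quasitriangular braided Lie bialgebra and that $(A,\alpha)$, with a bracket and a cobracket on $A$, is an $H$-module braided Lie algebra and an $H$-module braided Lie coalgebra. Define $$\phi=(\mathrm{id}_H\otimes\alpha)(C_{H,H}\otimes\mathrm{id}_A)(R\otimes\mathrm{id}_A):A\to H\otimes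 A .$$ If (SLB) holds on $A\otimes A$ for this $\alpha$ and $\phi$, then the bisum $(A\oplus H,[\,,]_D,\delta_D)$ determined by $\alpha$ and $\phi$ is a braided Lie bialgebra in $\mathcal C$. -/

import Mathlib

open CategoryTheory MonoidalCategory Limits

universe v u

namespace BraidedLie

/-- The braiding `C` is symmetric on a family `E` of objects:
`C_{U,V} = (C_{V,U})⁻¹` for all `U, V ∈ E` (including `U = V`). -/
def SymmetricOn {𝓒 : Type u} [Category.{v} 𝓒] [MonoidalCategory 𝓒] [BraidedCategory 𝓒]
    (E : Set 𝓒) : Prop :=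
  ∀ U ∈ E, ∀ V ∈ E, (β_ U V).hom = (β_ V U).inv

/-- `C₁₂ = C_{L,L} ⊗ id_L` on `(L ⊗ L) ⊗ L`. -/
def braid12 {𝓒 : Type u} [Category.{v} 𝓒] [MonoidalCategory 𝓒] [BraidedCategory 𝓒] (L : 𝓒) :
    (L ⊗ L) ⊗ L ⟶ (L ⊗ L) ⊗ L :=
  (β_ L L).hom ▷ L

/-- `C₂₃ = id_L ⊗ C_{L,L}`, transported to `(L ⊗ L) ⊗ L`. -/
def braid23 {𝓒 : Type u} [Category.{v} 𝓒] [MonoidalCategory 𝓒] [BraidedCategory 𝓒] (L : 𝓒) :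
    (L ⊗ L) ⊗ L ⟶ (L ⊗ L) ⊗ L :=
  (α_ L L L).hom ≫ L ◁ (β_ L L).hom ≫ (α_ L L L).inv

/-- Braided Lie algebra (on an object on which the braiding is symmetric). -/
structure IsLieAlgebra {𝓒 : Type u} [Category.{v} 𝓒] [MonoidalCategory 𝓒] [BraidedCategory 𝓒]
    [Preadditive 𝓒] (L : 𝓒) (br : L ⊗ L ⟶ L) : Prop where
  symmetric : SymmetricOn ({L} : Set 𝓒)
  antisymm : (𝟙 (L ⊗ L) + (β_ L L).hom) ≫ br = 0
  jacobi : (𝟙 ((L ⊗ L) ⊗ L) + braid23 L ≫ braid12 L + braid12 L ≫ braid23 L) ≫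
    br ▷ L ≫ br = 0

/-- Braided Lie coalgebra (on an object on which the braiding is symmetric). -/
structure IsLieCoalgebra {𝓒 : Type u} [Category.{v} 𝓒] [MonoidalCategory 𝓒] [BraidedCategory 𝓒]
    [Preadditive 𝓒] (L : 𝓒) (δ : L ⟶ L ⊗ L) : Prop where
  symmetric : SymmetricOn ({L} : Set 𝓒)
  coantisymm : δ ≫ (𝟙 (L ⊗ L) + (β_ L L).hom) = 0
  cojacobi : δ ≫ δ ▷ L ≫
    (𝟙 ((L ⊗ L) ⊗ L) + braid23 L ≫ braid12 L + braid12 L ≫ braid23 L) = 0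

/-- `x ⊗ y ↦ [x, y₁] ⊗ y₂ + y₁ ⊗ [x, y₂]`, the action of `L` on `δ y` by the bracket, with the
reordering in the second summand done by the braiding. -/
def adCobracket {𝓒 : Type u} [Category.{v} 𝓒] [MonoidalCategory 𝓒] [BraidedCategory 𝓒]
    [Preadditive 𝓒] {L : 𝓒} (br : L ⊗ L ⟶ L) (δ : L ⟶ L ⊗ L) : L ⊗ L ⟶ L ⊗ L :=
  L ◁ δ ≫ (α_ L L L).inv ≫ br ▷ L +
    L ◁ δ ≫ (α_ L L L).inv ≫ (β_ L L).hom ▷ L ≫ (α_ L L L).hom ≫ L ◁ br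

/-- Braided Lie bialgebra: the cobracket is a 1-cocycle. -/
structure IsLieBialgebra {𝓒 : Type u} [Category.{v} 𝓒] [MonoidalCategory 𝓒] [BraidedCategory 𝓒]
    [Preadditive 𝓒] (L : 𝓒) (br : L ⊗ L ⟶ L) (δ : L ⟶ L ⊗ L) : Prop where
  lieAlgebra : IsLieAlgebra L br
  lieCoalgebra : IsLieCoalgebra L δ
  cocycle : br ≫ δ = (𝟙 (L ⊗ L) - (β_ L L).hom) ≫ adCobracket br δ

/-- The coboundary condition `δ h = [h, R₁] ⊗ R₂ + R₁ ⊗ [h, R₂]` for `R : I ⟶ H ⊗ H`. -/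
def Coboundary {𝓒 : Type u} [Category.{v} 𝓒] [MonoidalCategory 𝓒] [BraidedCategory 𝓒]
    [Preadditive 𝓒] {H : 𝓒} (br : H ⊗ H ⟶ H) (δ : H ⟶ H ⊗ H) (R : 𝟙_ 𝓒 ⟶ H ⊗ H) : Prop :=
  δ = (ρ_ H).inv ≫ H ◁ R ≫ (α_ H H H).inv ≫
    (br ▷ H + (β_ H H).hom ▷ H ≫ (α_ H H H).hom ≫ H ◁ br)

/-- The classical Yang–Baxter equation `[R₁₂, R₁₃] + [R₁₂, R₂₃] + [R₁₃, R₂₃] = 0`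
(`tensorμ` exchanges the two middle tensor factors by the braiding). -/
def CYBE {𝓒 : Type u} [Category.{v} 𝓒] [MonoidalCategory 𝓒] [BraidedCategory 𝓒]
    [Preadditive 𝓒] {H : 𝓒} (br : H ⊗ H ⟶ H) (R : 𝟙_ 𝓒 ⟶ H ⊗ H) : Prop :=
  (λ_ (𝟙_ 𝓒)).inv ≫ (R ⊗ₘ R) ≫
    (tensorμ H H H H ≫ br ▷ (H ⊗ H) +
      (α_ H H (H ⊗ H)).hom ≫ H ◁ ((α_ H H H).inv ≫ br ▷ H) +
      tensorμ H H H H ≫ (H ⊗ H) ◁ br ≫ (α_ H H H).hom) = 0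

/-- Quasitriangular braided Lie bialgebra `(H, R)`. -/
structure IsQuasitriangular {𝓒 : Type u} [Category.{v} 𝓒] [MonoidalCategory 𝓒]
    [BraidedCategory 𝓒] [Preadditive 𝓒] (H : 𝓒) (br : H ⊗ H ⟶ H) (δ : H ⟶ H ⊗ H)
    (R : 𝟙_ 𝓒 ⟶ H ⊗ H) : Prop where
  lieBialgebra : IsLieBialgebra H br δ
  coboundary : Coboundary br δ R
  cybe : CYBE br R

/-- `(A, act)` is a left module over the bracket `brH` of `H`:
`[h, k] · a = h · (k · a) - k · (h · a)` up to the braiding. -/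
def IsModule {𝓒 : Type u} [Category.{v} 𝓒] [MonoidalCategory 𝓒] [BraidedCategory 𝓒]
    [Preadditive 𝓒] {A H : 𝓒} (brH : H ⊗ H ⟶ H) (act : H ⊗ A ⟶ A) : Prop :=
  brH ▷ A ≫ act =
    (α_ H H A).hom ≫ H ◁ act ≫ act -
      (β_ H H).hom ▷ A ≫ (α_ H H A).hom ≫ H ◁ act ≫ act

/-- `H`-module braided Lie algebra: a braided Lie algebra and `H`-module with
`h · [a, b] = [h · a, b] + [a, h · b]` up to the braiding. -/
structure IsModuleLieAlgebra {𝓒 : Type u} [Category.{v} 𝓒] [MonoidalCategory 𝓒]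
    [BraidedCategory 𝓒] [Preadditive 𝓒] {A H : 𝓒} (brH : H ⊗ H ⟶ H) (brA : A ⊗ A ⟶ A)
    (act : H ⊗ A ⟶ A) : Prop where
  lieAlgebra : IsLieAlgebra A brA
  isModule : IsModule brH act
  act_bracket : H ◁ brA ≫ act =
    (α_ H A A).inv ≫ act ▷ A ≫ brA +
      (α_ H A A).inv ≫ (β_ H A).hom ▷ A ≫ (α_ A H A).hom ≫ A ◁ act ≫ brA

/-- `H`-module braided Lie coalgebra: a braided Lie coalgebra and `H`-module with
`δ (h · a) = h · a₁ ⊗ a₂ + a₁ ⊗ h · a₂` up to the braiding. -/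
structure IsModuleLieCoalgebra {𝓒 : Type u} [Category.{v} 𝓒] [MonoidalCategory 𝓒]
    [BraidedCategory 𝓒] [Preadditive 𝓒] {A H : 𝓒} (brH : H ⊗ H ⟶ H) (δA : A ⟶ A ⊗ A)
    (act : H ⊗ A ⟶ A) : Prop where
  lieCoalgebra : IsLieCoalgebra A δA
  isModule : IsModule brH act
  act_cobracket : act ≫ δA =
    H ◁ δA ≫ (α_ H A A).inv ≫ act ▷ A +
      H ◁ δA ≫ (α_ H A A).inv ≫ (β_ H A).hom ▷ A ≫ (α_ A H A).hom ≫ A ◁ act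

/-- The coaction `φ : A ⟶ H ⊗ A`, `a ↦ R₂ ⊗ R₁ · a`. -/
def coactionOfR {𝓒 : Type u} [Category.{v} 𝓒] [MonoidalCategory 𝓒] [BraidedCategory 𝓒]
    {A H : 𝓒} (R : 𝟙_ 𝓒 ⟶ H ⊗ H) (act : H ⊗ A ⟶ A) : A ⟶ H ⊗ A :=
  (λ_ A).inv ≫ R ▷ A ≫ (β_ H H).hom ▷ A ≫ (α_ H H A).hom ≫ H ◁ act

/-- The infinitesimal braiding: writing `φ a = a₍₋₁₎ ⊗ a₍₀₎`,
`a ⊗ b ↦ b₍₋₁₎ · a ⊗ b₍₀₎ + a₍₀₎ ⊗ a₍₋₁₎ · b - a₍₋₁₎ · b ⊗ a₍₀₎ - b₍₀₎ ⊗ b₍₋₁₎ · a`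
up to the braiding. -/
def infBraiding {𝓒 : Type u} [Category.{v} 𝓒] [MonoidalCategory 𝓒] [BraidedCategory 𝓒]
    [Preadditive 𝓒] {A H : 𝓒} (act : H ⊗ A ⟶ A) (φ : A ⟶ H ⊗ A) : A ⊗ A ⟶ A ⊗ A :=
  A ◁ φ ≫ (α_ A H A).inv ≫ (β_ A H).hom ▷ A ≫ act ▷ A +
    φ ▷ A ≫ (β_ H A).hom ▷ A ≫ (α_ A H A).hom ≫ A ◁ act -
    φ ▷ A ≫ (α_ H A A).hom ≫ H ◁ (β_ A A).hom ≫ (α_ H A A).inv ≫ act ▷ A -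
    A ◁ φ ≫ (α_ A H A).inv ≫ (β_ A H).hom ▷ A ≫ (α_ H A A).hom ≫ H ◁ (β_ A A).hom ≫
      (α_ H A A).inv ≫ (β_ H A).hom ▷ A ≫ (α_ A H A).hom ≫ A ◁ act

/-- The condition (SLB) on `A ⊗ A`: the cobracket of `A` is a 1-cocycle up to the infinitesimal
braiding. -/
def SLB {𝓒 : Type u} [Category.{v} 𝓒] [MonoidalCategory 𝓒] [BraidedCategory 𝓒]
    [Preadditive 𝓒] {A H : 𝓒} (brA : A ⊗ A ⟶ A) (δA : A ⟶ A ⊗ A) (act : H ⊗ A ⟶ A)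
    (φ : A ⟶ H ⊗ A) : Prop :=
  brA ≫ δA = (𝟙 (A ⊗ A) - (β_ A A).hom) ≫ adCobracket brA δA - infBraiding act φ

/-- The bracket of the bisum on `A ⊕ H`:
`[a + h, b + k] = ([a, b] + h · b - k · a) + [h, k]`, the reordering in `k · a` being done by the
braiding. -/
noncomputable def bisumBracket {𝓒 : Type u} [Category.{v} 𝓒] [MonoidalCategory 𝓒]
    [BraidedCategory 𝓒] [Preadditive 𝓒] [HasBinaryBiproducts 𝓒] {A H : 𝓒} (brA : A ⊗ A ⟶ A)
    (brH : H ⊗ H ⟶ H) (act : H ⊗ A ⟶ A) : (A ⊞ H) ⊗ (A ⊞ H) ⟶ A ⊞ H :=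
  ((biprod.fst ⊗ₘ biprod.fst) ≫ brA + (biprod.snd ⊗ₘ biprod.fst) ≫ act -
      (biprod.fst ⊗ₘ biprod.snd) ≫ (β_ A H).hom ≫ act) ≫ biprod.inl +
    ((biprod.snd ⊗ₘ biprod.snd) ≫ brH) ≫ biprod.inr

/-- The cobracket of the bisum on `A ⊕ H`:
`δ (a + h) = δ a + φ a - C (φ a) + δ h`. -/
noncomputable def bisumCobracket {𝓒 : Type u} [Category.{v} 𝓒] [MonoidalCategory 𝓒]
    [BraidedCategory 𝓒] [Preadditive 𝓒] [HasBinaryBiproducts 𝓒] {A H : 𝓒} (δA : A ⟶ A ⊗ A)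
    (δH : H ⟶ H ⊗ H) (φ : A ⟶ H ⊗ A) : A ⊞ H ⟶ (A ⊞ H) ⊗ (A ⊞ H) :=
  biprod.fst ≫ (δA ≫ (biprod.inl ⊗ₘ biprod.inl) + φ ≫ (biprod.inr ⊗ₘ biprod.inl) -
      φ ≫ (β_ H A).hom ≫ (biprod.inl ⊗ₘ biprod.inr)) +
    biprod.snd ≫ δH ≫ (biprod.inr ⊗ₘ biprod.inr)

end BraidedLie

/-! Extend every structure map by zero to the single object D = A ⊕ H: `b`, `g`, `r` are the bracket
of A, the bracket of H and the action, and `d`, `e`, `φ` the two cobrackets and the coaction. The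
bisum bracket is then b + r - Cr + g, and the cobracket is d + φ - Cφ + e. Since C² = 1 on D ⊗ D,
`braid12` and `braid23` generate an action of S₃ on D ⊗ D ⊗ D, so each axiom becomes a computation
with permutations. Composites whose summands do not match vanish.

Write Q for R with its legs exchanged, so that φ(a) = Q₁ ⊗ Q₂·a; formulas with elements are up to
the braiding. Three facts make A a Yetter–Drinfeld type module over H. Since H acts on A by
derivations and coderivations, φ is compatible with the bracket and cobracket of A
(`bracket_coaction`, `coaction_cobracket`). The Yang–Baxter equation gives (δ_H ⊗ id)φ = (id -
C₁₂)(id ⊗ φ)φ, the comodule law (`coaction_comul`). The coboundary form of δ_H, with the module law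
(`act_coaction`), gives φ(h·a) = [h, a₍₋₁₎] ⊗ a₍₀₎ + a₍₋₁₎ ⊗ h·a₍₀₎ + h₁ ⊗ h₂·a.

With these, the mixed terms of Jacobi and co-Jacobi assemble into a multiple of an element of ℤ[S₃]
annihilated by the cyclic sum. In the cocycle identity, the mixed terms on A ⊗ A → A ⊗ A are exactly
the infinitesimal braiding, which (SLB) compensates. -/

namespace BraidedLie

/-! ### The S₃-action on D ⊗ D ⊗ D and its exchange with products and coproducts -/

section Calculus

variable {𝓒 : Type u} [Category.{v} 𝓒] [MonoidalCategory 𝓒]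

/-- A product applied to the last two factors of `(D ⊗ D) ⊗ D`. -/
def mul23 {D : 𝓒} (m : D ⊗ D ⟶ D) : (D ⊗ D) ⊗ D ⟶ D ⊗ D :=
  (α_ D D D).hom ≫ D ◁ m

/-- A coproduct applied to the last factor of `D ⊗ D`. -/
def comul23 {D : 𝓒} (c : D ⟶ D ⊗ D) : D ⊗ D ⟶ (D ⊗ D) ⊗ D :=
  D ◁ c ≫ (α_ D D D).inv

variable [BraidedCategory 𝓒]

theorem braid_braid {D : 𝓒} : braid12 D ≫ braid23 D ≫ braid12 D =
    braid23 D ≫ braid12 D ≫ braid23 D := by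
  simp only [braid12, braid23]
  have := BraidedCategory.yang_baxter D D D
  rw [← cancel_mono (α_ D D D).hom, ← cancel_epi (α_ D D D).inv]
  simpa using this

theorem braid12_braid12 {D : 𝓒} (h : (β_ D D).hom ≫ (β_ D D).hom = 𝟙 _) :
    braid12 D ≫ braid12 D = 𝟙 _ := by
  simp [braid12, ← comp_whiskerRight, h]

theorem braid23_braid23 {D : 𝓒} (h : (β_ D D).hom ≫ (β_ D D).hom = 𝟙 _) :
    braid23 D ≫ braid23 D = 𝟙 _ := by
  simp [braid23, ← whiskerLeft_comp_assoc, h]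

/-- Naturality and the hexagon: a braiding moved past a product becomes a 3-cycle. With the next
three lemmas, this lets all permutations be collected on the three-factor object. -/
theorem mul12_braiding {D : 𝓒} (m : D ⊗ D ⟶ D) :
    m ▷ D ≫ (β_ D D).hom = braid23 D ≫ braid12 D ≫ mul23 m := by
  simp [braid12, braid23, mul23, BraidedCategory.braiding_naturality_left,
    BraidedCategory.braiding_tensor_left_hom]

theorem mul23_braiding {D : 𝓒} (m : D ⊗ D ⟶ D) :
    mul23 m ≫ (β_ D D).hom = braid12 D ≫ braid23 D ≫ m ▷ D := by
  simp [braid12, braid23, mul23, BraidedCategory.braiding_naturality_right,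
    BraidedCategory.braiding_tensor_right_hom]

theorem braiding_comul12 {D : 𝓒} (c : D ⟶ D ⊗ D) :
    (β_ D D).hom ≫ c ▷ D = comul23 c ≫ braid12 D ≫ braid23 D := by
  simp [braid12, braid23, comul23, ← BraidedCategory.braiding_naturality_right,
    BraidedCategory.braiding_tensor_right_hom]

theorem braiding_comul23 {D : 𝓒} (c : D ⟶ D ⊗ D) :
    (β_ D D).hom ≫ comul23 c = c ▷ D ≫ braid23 D ≫ braid12 D := by
  simp [braid12, braid23, comul23, ← BraidedCategory.braiding_naturality_left_assoc,
    BraidedCategory.braiding_tensor_left_hom]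

theorem braid12_mul12 {D : 𝓒} (m : D ⊗ D ⟶ D) :
    braid12 D ≫ m ▷ D = ((β_ D D).hom ≫ m) ▷ D := by simp [braid12]

theorem comul12_braid12 {D : 𝓒} (c : D ⟶ D ⊗ D) :
    c ▷ D ≫ braid12 D = (c ≫ (β_ D D).hom) ▷ D := by simp [braid12]

theorem braid23_mul23 {D : 𝓒} (m : D ⊗ D ⟶ D) :
    braid23 D ≫ mul23 m = mul23 ((β_ D D).hom ≫ m) := by simp [braid23, mul23]

theorem comul23_braid23 {D : 𝓒} (c : D ⟶ D ⊗ D) :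
    comul23 c ≫ braid23 D = comul23 (c ≫ (β_ D D).hom) := by simp [braid23, comul23]

end Calculus

/-! ### Additivity of whiskering -/

section Additive

variable {𝓒 : Type u} [Category.{v} 𝓒] [MonoidalCategory 𝓒] [Preadditive 𝓒]
  [MonoidalPreadditive 𝓒]

theorem mul23_add {D : 𝓒} (m m' : D ⊗ D ⟶ D) : mul23 (m + m') = mul23 m + mul23 m' := by
  simp [mul23]

theorem mul23_neg {D : 𝓒} (m : D ⊗ D ⟶ D) : mul23 (-m) = -mul23 m :=
  map_neg (AddMonoidHom.mk' (mul23 (D := D)) mul23_add) m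

theorem mul23_sub {D : 𝓒} (m m' : D ⊗ D ⟶ D) : mul23 (m - m') = mul23 m - mul23 m' :=
  map_sub (AddMonoidHom.mk' (mul23 (D := D)) mul23_add) m m'

theorem comul23_add {D : 𝓒} (m m' : D ⟶ D ⊗ D) :
    comul23 (m + m') = comul23 m + comul23 m' := by
  simp [comul23]

theorem comul23_sub {D : 𝓒} (m m' : D ⟶ D ⊗ D) :
    comul23 (m - m') = comul23 m - comul23 m' :=
  map_sub (AddMonoidHom.mk' (comul23 (D := D)) comul23_add) m m'

theorem whiskerRight_neg {X Y : 𝓒} (f : X ⟶ Y) (Z : 𝓒) : (-f) ▷ Z = -(f ▷ Z) :=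
  map_neg (AddMonoidHom.mk' (fun f : X ⟶ Y => f ▷ Z)
    (fun _ _ => MonoidalPreadditive.add_whiskerRight _ _)) f

theorem whiskerRight_sub {X Y : 𝓒} (f g : X ⟶ Y) (Z : 𝓒) : (f - g) ▷ Z = f ▷ Z - g ▷ Z :=
  map_sub (AddMonoidHom.mk' (fun f : X ⟶ Y => f ▷ Z)
    (fun _ _ => MonoidalPreadditive.add_whiskerRight _ _)) f g

theorem whiskerLeft_neg {X Y : 𝓒} (f : X ⟶ Y) (Z : 𝓒) : Z ◁ (-f) = -(Z ◁ f) :=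
  map_neg (AddMonoidHom.mk' (fun f : X ⟶ Y => Z ◁ f)
    (fun _ _ => MonoidalPreadditive.whiskerLeft_add _ _)) f

theorem whiskerLeft_sub {X Y : 𝓒} (f g : X ⟶ Y) (Z : 𝓒) : Z ◁ (f - g) = Z ◁ f - Z ◁ g :=
  map_sub (AddMonoidHom.mk' (fun f : X ⟶ Y => Z ◁ f)
    (fun _ _ => MonoidalPreadditive.whiskerLeft_add _ _)) f g

end Additive

/-! ### The three bialgebra axioms on D from relations between the components -/

section Bisum

variable {𝓒 : Type u} [Category.{v} 𝓒] [MonoidalCategory 𝓒] [BraidedCategory 𝓒]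
  [Preadditive 𝓒]

/-- The sum over the 3-cycles absorbs every 3-cycle, and times any transposition it gives the sum of
all three transpositions. So the four terms, two even and two odd, cancel in pairs. -/
theorem cyclicSum_comp_eq_zero {D : 𝓒} (hβ : (β_ D D).hom ≫ (β_ D D).hom = 𝟙 _) :
    (𝟙 ((D ⊗ D) ⊗ D) + braid23 D ≫ braid12 D + braid12 D ≫ braid23 D) ≫
      (𝟙 _ - braid12 D - braid23 D ≫ braid12 D + braid12 D ≫ braid23 D ≫ braid12 D) = 0 := by
  have h1 := braid12_braid12 hβ
  have h2 := braid23_braid23 hβ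
  have h3 := (braid_braid (D := D)).symm
  simp only [Preadditive.comp_add, Preadditive.add_comp, Preadditive.comp_sub,
    Category.assoc, Category.comp_id, Category.id_comp,
    reassoc_of% h3, h1, reassoc_of% h1, reassoc_of% h2]
  abel

theorem comp_cyclicSum_eq_zero {D : 𝓒} (hβ : (β_ D D).hom ≫ (β_ D D).hom = 𝟙 _) :
    (𝟙 _ - braid12 D - braid12 D ≫ braid23 D + braid12 D ≫ braid23 D ≫ braid12 D) ≫
      (𝟙 ((D ⊗ D) ⊗ D) + braid23 D ≫ braid12 D + braid12 D ≫ braid23 D) = 0 := by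
  have h1 := braid12_braid12 hβ
  have h2 := braid23_braid23 hβ
  have h3 := (braid_braid (D := D)).symm
  simp only [Preadditive.comp_add, Preadditive.add_comp,
    Preadditive.sub_comp, Category.assoc, Category.comp_id, Category.id_comp, h3,
    reassoc_of% h3, h1, h2, reassoc_of% h1, reassoc_of% h2]
  abel

variable [MonoidalPreadditive 𝓒]

/-- The module and derivation laws reduce all mixed double brackets to permutations of [h·a, a'] and
h·(k·a). Both occur with the same coefficient in ℤ[S₃], which the cyclic sum kills. -/
theorem bisum_jacobi {D : 𝓒} (hβ : (β_ D D).hom ≫ (β_ D D).hom = 𝟙 _) {b g r : D ⊗ D ⟶ D}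
    (hb : IsLieAlgebra D b) (hg : IsLieAlgebra D g)
    (hgr : g ▷ D ≫ r = mul23 r ≫ r - braid12 D ≫ mul23 r ≫ r)
    (hrb : mul23 b ≫ r = r ▷ D ≫ b + braid12 D ≫ mul23 r ≫ b)
    (h1 : b ▷ D ≫ g = 0) (h2 : g ▷ D ≫ b = 0) (h3 : r ▷ D ≫ g = 0) (h4 : b ▷ D ≫ r = 0)
    (h5 : mul23 g ≫ r = 0) (h6 : r ▷ D ≫ r = 0) :
    (𝟙 ((D ⊗ D) ⊗ D) + braid23 D ≫ braid12 D + braid12 D ≫ braid23 D) ≫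
      (b + r - (β_ D D).hom ≫ r + g) ▷ D ≫ (b + r - (β_ D D).hom ≫ r + g) = 0 := by
  have hb' : (β_ D D).hom ≫ b = -b := by
    have := hb.antisymm
    rw [Preadditive.add_comp, Category.id_comp] at this
    exact eq_neg_of_add_eq_zero_right this
  -- Antisymmetry, [a', h·a] = -[h·a, a'], leaves a single normal form for terms with one action and
  -- one bracket.
  have e1 : mul23 r ≫ b = -(braid12 D ≫ braid23 D ≫ r ▷ D ≫ b) := by
    rw [← reassoc_of% mul23_braiding r, hb', Preadditive.comp_neg, neg_neg]
  have e2 : (b + r - (β_ D D).hom ≫ r + g) ▷ D ≫ (b + r - (β_ D D).hom ≫ r + g) =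
      b ▷ D ≫ b + g ▷ D ≫ g +
      (𝟙 _ - braid12 D - braid23 D ≫ braid12 D + braid12 D ≫ braid23 D ≫ braid12 D) ≫
        (r ▷ D ≫ b + mul23 r ≫ r) := by
    have n := fun (m : D ⊗ D ⟶ D) => reassoc_of% mul12_braiding m
    have s1 := braid12_braid12 hβ
    have s3 := braid_braid (D := D)
    simp only [MonoidalPreadditive.add_whiskerRight, whiskerRight_sub, Preadditive.comp_add,
      Preadditive.add_comp, Preadditive.sub_comp, Preadditive.comp_sub, comp_whiskerRight,
      Category.assoc, Category.id_comp, n, h1, h2, h3, h4, h5, h6, hgr, hrb, comp_zero,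
      ← braid12.eq_1, e1, Preadditive.comp_neg, reassoc_of% s1, reassoc_of% s3]
    abel
  rw [e2, Preadditive.comp_add, Preadditive.comp_add, hb.jacobi, hg.jacobi,
    ← Category.assoc, cyclicSum_comp_eq_zero hβ]
  simp

/-- Dual to the Jacobi computation: `heφ` is the comodule law and `hdφ` says that the cobracket of A
is compatible with the coaction. -/
theorem bisum_cojacobi {D : 𝓒} (hβ : (β_ D D).hom ≫ (β_ D D).hom = 𝟙 _) {d e φ : D ⟶ D ⊗ D}
    (hd : IsLieCoalgebra D d) (he : IsLieCoalgebra D e)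
    (heφ : φ ≫ e ▷ D = φ ≫ comul23 φ - φ ≫ comul23 φ ≫ braid12 D)
    (hdφ : φ ≫ comul23 d = d ≫ φ ▷ D + d ≫ comul23 φ ≫ braid12 D)
    (h1 : d ≫ e ▷ D = 0) (h2 : e ≫ d ▷ D = 0) (h3 : e ≫ φ ▷ D = 0) (h4 : φ ≫ φ ▷ D = 0)
    (h5 : φ ≫ d ▷ D = 0) (h6 : φ ≫ comul23 e = 0) :
    (d + φ - φ ≫ (β_ D D).hom + e) ≫ (d + φ - φ ≫ (β_ D D).hom + e) ▷ D ≫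
      (𝟙 ((D ⊗ D) ⊗ D) + braid23 D ≫ braid12 D + braid12 D ≫ braid23 D) = 0 := by
  have hd' : d = -(d ≫ (β_ D D).hom) := by
    have := hd.coantisymm
    rw [Preadditive.comp_add, Category.comp_id] at this
    exact eq_neg_of_add_eq_zero_left this
  have e1 : d ≫ comul23 φ = -(d ≫ φ ▷ D ≫ braid23 D ≫ braid12 D) := by
    rw [← braiding_comul23]
    nth_rw 1 [hd']
    simp
  have e2 : (d + φ - φ ≫ (β_ D D).hom + e) ≫ (d + φ - φ ≫ (β_ D D).hom + e) ▷ D =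
      d ≫ d ▷ D + e ≫ e ▷ D + (d ≫ φ ▷ D + φ ≫ comul23 φ) ≫
      (𝟙 _ - braid12 D - braid12 D ≫ braid23 D + braid12 D ≫ braid23 D ≫ braid12 D) := by
    have n := fun (m : D ⟶ D ⊗ D) => braiding_comul12 m
    have n' := fun (m : D ⟶ D ⊗ D) => reassoc_of% braiding_comul12 m
    have s1 := braid12_braid12 hβ
    have s3 := (braid_braid (D := D)).symm
    simp only [MonoidalPreadditive.add_whiskerRight, whiskerRight_sub, Preadditive.comp_add,
      Preadditive.add_comp, Preadditive.sub_comp, Preadditive.comp_sub, comp_whiskerRight,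
      Category.assoc, Category.comp_id, n, n', h1, h2, h3, h4, h5, heφ, zero_comp,
      reassoc_of% h3, reassoc_of% h4, reassoc_of% h6, reassoc_of% hdφ,
      ← braid12.eq_1, reassoc_of% e1, Preadditive.neg_comp, reassoc_of% s1, s3]
    abel
  rw [← Category.assoc, e2, Preadditive.add_comp, Preadditive.add_comp, Category.assoc,
    Category.assoc, hd.cojacobi, he.cojacobi, Category.assoc, comp_cyclicSum_eq_zero hβ]
  simp

set_option maxHeartbeats 400000 in
-- Expanding both sides, the hypotheses from `h1` on remove composites with mismatched summands. The
-- survivors on A ⊗ A match by `hbd` and `hbφ`, those on H ⊗ A and A ⊗ H by `hrd` and `hrφ`, those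
-- on H ⊗ H by `hge`.
theorem bisum_cocycle {D : 𝓒} (hβ : (β_ D D).hom ≫ (β_ D D).hom = 𝟙 _) {b g r : D ⊗ D ⟶ D}
    {d e φ : D ⟶ D ⊗ D} (hb' : (β_ D D).hom ≫ b = -b) (he' : e ≫ (β_ D D).hom = -e)
    (hge : g ≫ e = (𝟙 (D ⊗ D) - (β_ D D).hom) ≫ adCobracket g e)
    (hbd : SLB b d r φ)
    (hrd : r ≫ d = comul23 d ≫ r ▷ D + comul23 d ≫ braid12 D ≫ mul23 r)
    (hbφ : b ≫ φ = φ ▷ D ≫ mul23 b + comul23 φ ≫ braid12 D ≫ mul23 b)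
    (hrφ : r ≫ φ = comul23 φ ≫ g ▷ D + comul23 φ ≫ braid12 D ≫ mul23 r + e ▷ D ≫ mul23 r)
    (h1 : b ≫ e = 0) (h2 : g ≫ d = 0) (h3 : g ≫ φ = 0) (h4 : r ≫ e = 0)
    (d1 : comul23 d ≫ g ▷ D = 0) (d2 : comul23 d ≫ braid12 D ≫ mul23 g = 0)
    (d3 : comul23 d ≫ braid12 D ≫ r ▷ D = 0)
    (d4 : comul23 d ≫ braid12 D ≫ braid23 D ≫ mul23 r = 0)
    (e1 : comul23 e ≫ b ▷ D = 0) (e2 : comul23 e ≫ braid12 D ≫ mul23 b = 0)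
    (e3 : comul23 e ≫ r ▷ D = 0) (e4 : comul23 e ≫ braid12 D ≫ mul23 r = 0)
    (f1 : comul23 φ ≫ b ▷ D = 0) (f2 : comul23 φ ≫ braid23 D ≫ braid12 D ≫ mul23 b = 0)
    (f3 : comul23 φ ≫ braid12 D ≫ mul23 g = 0) (f4 : comul23 φ ≫ braid23 D ≫ g ▷ D = 0)
    (f5 : comul23 φ ≫ r ▷ D = 0) (f6 : comul23 φ ≫ braid12 D ≫ braid23 D ≫ mul23 r = 0)
    (f7 : comul23 φ ≫ braid23 D ≫ braid12 D ≫ r ▷ D = 0)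
    (f8 : comul23 φ ≫ braid23 D ≫ braid12 D ≫ mul23 r = 0) :
    (b + r - (β_ D D).hom ≫ r + g) ≫ (d + φ - φ ≫ (β_ D D).hom + e) =
      (𝟙 (D ⊗ D) - (β_ D D).hom) ≫
        adCobracket (b + r - (β_ D D).hom ≫ r + g) (d + φ - φ ≫ (β_ D D).hom + e) := by
  have had : ∀ (m : D ⊗ D ⟶ D) (c : D ⟶ D ⊗ D), adCobracket m c =
      comul23 c ≫ m ▷ D + comul23 c ≫ braid12 D ≫ mul23 m := by
    intro m c
    simp [adCobracket, comul23, braid12, mul23]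
  have hinf : infBraiding r φ = comul23 φ ≫ braid12 D ≫ r ▷ D + φ ▷ D ≫ braid12 D ≫ mul23 r -
      φ ▷ D ≫ braid23 D ≫ r ▷ D -
      comul23 φ ≫ braid12 D ≫ braid23 D ≫ braid12 D ≫ mul23 r := by
    simp [infBraiding, comul23, braid12, braid23, mul23]
  have s1 := braid12_braid12 hβ
  have s2 := braid23_braid23 hβ
  have s3 := (braid_braid (D := D)).symm
  have b1 : braid12 D ≫ b ▷ D = -(b ▷ D) := by rw [braid12_mul12, hb', whiskerRight_neg]
  have b2 : braid23 D ≫ mul23 b = -(mul23 b) := by rw [braid23_mul23, hb', mul23_neg]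
  have c1 : e ▷ D ≫ braid12 D = -(e ▷ D) := by
    rw [comul12_braid12, he', whiskerRight_neg]
  rw [SLB] at hbd
  rw [had, hinf] at hbd
  rw [had] at hge
  rw [had]
  have n1 := fun (m : D ⊗ D ⟶ D) => mul12_braiding m
  have n2 := fun (m : D ⊗ D ⟶ D) => mul23_braiding m
  have n3 := fun (m : D ⟶ D ⊗ D) => braiding_comul12 m
  have n4 := fun (m : D ⟶ D ⊗ D) => braiding_comul23 m
  have n3' := fun (m : D ⟶ D ⊗ D) => reassoc_of% braiding_comul12 m
  have n4' := fun (m : D ⟶ D ⊗ D) => reassoc_of% braiding_comul23 m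
  simp only [MonoidalPreadditive.add_whiskerRight, whiskerRight_sub, Preadditive.comp_add,
    Preadditive.add_comp, Preadditive.sub_comp, Preadditive.comp_sub, comp_whiskerRight,
    Category.assoc, Category.id_comp, mul23_add, mul23_sub, comul23_add, comul23_sub,
    ← braid23_mul23, ← comul23_braid23, ← braid12.eq_1,
    h1, h2, h3, h4, d1, d2, d3, d4, e1, e2, e3, e4, f1, f2, f3, f4, f5, f6, f7, f8,
    reassoc_of% h3, comp_zero, hge, hbd, hrd, reassoc_of% hbφ, hbφ, hrφ, reassoc_of% hrφ,
    n1, n2, n3', n4', reassoc_of% s1, reassoc_of% s2, reassoc_of% s3, b1, b2, reassoc_of% c1,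
    Preadditive.comp_neg, Preadditive.neg_comp, add_zero, zero_add, sub_zero, zero_sub,
    zero_comp, sub_neg_eq_add, neg_sub]
  abel

end Bisum

/-! ### Inserting a two-tensor, and coactions of the form z ↦ Q₁ ⊗ Q₂·z -/

section Insertion

variable {𝓒 : Type u} [Category.{v} 𝓒] [MonoidalCategory 𝓒]

/-- `z ↦ Q₁ ⊗ w (Q₂ ⊗ z)`. -/
def insertLeft {D Z W : 𝓒} (Q : 𝟙_ 𝓒 ⟶ D ⊗ D) (w : D ⊗ Z ⟶ W) : Z ⟶ D ⊗ W :=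
  (λ_ Z).inv ≫ Q ▷ Z ≫ (α_ D D Z).hom ≫ D ◁ w

/-- `x ↦ x ⊗ Q₁ ⊗ Q₂`. -/
def insertRight {D : 𝓒} (Q : 𝟙_ 𝓒 ⟶ D ⊗ D) : D ⟶ (D ⊗ D) ⊗ D :=
  (ρ_ D).inv ≫ D ◁ Q ≫ (α_ D D D).inv

theorem comp_insertLeft {D Z Z' W : 𝓒} (Q : 𝟙_ 𝓒 ⟶ D ⊗ D) (f : Z' ⟶ Z) (w : D ⊗ Z ⟶ W) :
    f ≫ insertLeft Q w = insertLeft Q (D ◁ f ≫ w) := by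
  simp only [insertLeft, leftUnitor_inv_naturality_assoc, whisker_exchange_assoc]
  simp

theorem insertLeft_comp {D Z W W' : 𝓒} (Q : 𝟙_ 𝓒 ⟶ D ⊗ D) (w : D ⊗ Z ⟶ W) (v : W ⟶ W') :
    insertLeft Q w ≫ D ◁ v = insertLeft Q (w ≫ v) := by
  simp [insertLeft]

theorem insertLeft_whiskerRight {D Z W : 𝓒} (Q : 𝟙_ 𝓒 ⟶ D ⊗ D) (w : D ⊗ Z ⟶ W) (X : 𝓒) :
    insertLeft Q w ▷ X = insertLeft Q ((α_ D Z X).inv ≫ w ▷ X) ≫ (α_ D W X).inv := by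
  simp only [insertLeft]
  monoidal

theorem whiskerRight_insertLeft {D Z W : 𝓒} (Q : 𝟙_ 𝓒 ⟶ D ⊗ D) (c : D ⟶ D ⊗ D)
    (w : D ⊗ Z ⟶ W) :
    insertLeft Q w ≫ c ▷ W =
      (λ_ Z).inv ≫ (Q ≫ c ▷ D) ▷ Z ≫ (α_ (D ⊗ D) D Z).hom ≫ (D ⊗ D) ◁ w := by
  simp [insertLeft, whisker_exchange]

theorem insertLeft_comul {D Z W : 𝓒} (Q : 𝟙_ 𝓒 ⟶ D ⊗ D) (c : D ⟶ D ⊗ D)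
    (w : D ⊗ Z ⟶ W) :
    (λ_ Z).inv ≫ (Q ≫ comul23 c) ▷ Z ≫ (α_ (D ⊗ D) D Z).hom ≫ (D ⊗ D) ◁ w =
      insertLeft Q (c ▷ Z ≫ (α_ D D Z).hom ≫ D ◁ w) ≫ (α_ D D W).inv := by
  simp only [insertLeft, comul23]
  monoidal

/-- Operations on the two legs of Q are independent: both sides are h ⊗ a ↦ [h, Q₁] ⊗ Q₂·a. -/
theorem insertRight_whiskerRight {D : 𝓒} (Q : 𝟙_ 𝓒 ⟶ D ⊗ D) (g r : D ⊗ D ⟶ D) :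
    (insertRight Q ≫ g ▷ D) ▷ D ≫ mul23 r = comul23 (insertLeft Q r) ≫ g ▷ D := by
  simp only [insertLeft, insertRight, mul23, comul23, comp_whiskerRight, whiskerLeft_comp,
    Category.assoc, associator_naturality_left_assoc, associator_inv_naturality_right_assoc,
    ← whisker_exchange]
  monoidal

theorem insertLeft_mul {D : 𝓒} (Q : 𝟙_ 𝓒 ⟶ D ⊗ D) (r : D ⊗ D ⟶ D) :
    insertLeft Q r = (λ_ D).inv ≫ Q ▷ D ≫ mul23 r := rfl

/-- Two copies of R side by side are the same as one copy with the other created to the right of its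
second leg. This lets Yang–Baxter terms be read as R followed by a map on one leg. -/
theorem tensor_insert {D : 𝓒} (R : 𝟙_ 𝓒 ⟶ D ⊗ D) :
    (λ_ (𝟙_ 𝓒)).inv ≫ (R ⊗ₘ R) ≫ (α_ D D (D ⊗ D)).hom = R ≫ D ◁ ((ρ_ D).inv ≫ D ◁ R) := by
  rw [MonoidalCategory.tensorHom_def, unitors_inv_equal]
  monoidal

section

variable [Preadditive 𝓒] [MonoidalPreadditive 𝓒]

theorem insertLeft_add {D Z W : 𝓒} (Q : 𝟙_ 𝓒 ⟶ D ⊗ D) (w w' : D ⊗ Z ⟶ W) :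
    insertLeft Q (w + w') = insertLeft Q w + insertLeft Q w' := by
  simp [insertLeft]

theorem insertLeft_sub {D Z W : 𝓒} (Q : 𝟙_ 𝓒 ⟶ D ⊗ D) (w w' : D ⊗ Z ⟶ W) :
    insertLeft Q (w - w') = insertLeft Q w - insertLeft Q w' := by
  simp [insertLeft, whiskerLeft_sub]

end

variable [BraidedCategory 𝓒]

/-- Q comes from the unit object, with which the braiding is trivial, so x passes both legs of Q at
no cost. -/
theorem insertRight_braiding {D : 𝓒} (Q : 𝟙_ 𝓒 ⟶ D ⊗ D) :
    insertRight Q ≫ braid12 D ≫ braid23 D = (λ_ D).inv ≫ Q ▷ D := by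
  have := (ρ_ D).inv ≫= BraidedCategory.braiding_naturality_right D Q
  rw [BraidedCategory.braiding_tensor_right_hom] at this
  simp only [braiding_tensorUnit_right, Iso.inv_hom_id_assoc, Category.assoc] at this
  rw [← this]
  simp [insertRight, braid12, braid23]

theorem insertRight_braid12 {D : 𝓒} (hβ : (β_ D D).hom ≫ (β_ D D).hom = 𝟙 _)
    (Q : 𝟙_ 𝓒 ⟶ D ⊗ D) :
    insertRight Q ≫ braid12 D = (λ_ D).inv ≫ Q ▷ D ≫ braid23 D := by
  rw [← reassoc_of% insertRight_braiding Q, braid23_braid23 hβ, Category.comp_id]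

/-- Passing a factor over the first leg of Q equals creating Q on its left and passing it over the
second leg, because C² = 1. -/
theorem whiskerLeft_insertLeft {D Z W : 𝓒} (hβ : (β_ D D).hom ≫ (β_ D D).hom = 𝟙 _)
    (Q : 𝟙_ 𝓒 ⟶ D ⊗ D) (w : D ⊗ Z ⟶ W) :
    D ◁ insertLeft Q w ≫ (α_ D D W).inv ≫ (β_ D D).hom ▷ W ≫ (α_ D D W).hom =
      insertLeft Q ((α_ D D Z).inv ≫ (β_ D D).hom ▷ Z ≫ (α_ D D Z).hom ≫ D ◁ w) := by
  have h1 : D ◁ insertLeft Q w ≫ (α_ D D W).inv ≫ (β_ D D).hom ▷ W ≫ (α_ D D W).hom =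
      (insertRight Q ≫ braid12 D) ▷ Z ≫ (α_ (D ⊗ D) D Z).hom ≫ (D ⊗ D) ◁ w ≫
        (α_ D D W).hom := by
    simp only [insertLeft, insertRight, braid12, comp_whiskerRight, whiskerLeft_comp,
      Category.assoc, associator_naturality_left_assoc, associator_inv_naturality_right_assoc,
      ← whisker_exchange_assoc]
    monoidal
  rw [h1, insertRight_braid12 hβ]
  simp only [insertLeft, braid23]
  monoidal

theorem insertRight_braid23 {D : 𝓒} (Q : 𝟙_ 𝓒 ⟶ D ⊗ D) :
    insertRight Q ≫ braid23 D = insertRight (Q ≫ (β_ D D).hom) := by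
  simp [insertRight, braid23]

theorem coactionOfR_eq {D : 𝓒} (R : 𝟙_ 𝓒 ⟶ D ⊗ D) (r : D ⊗ D ⟶ D) :
    coactionOfR R r = insertLeft (R ≫ (β_ D D).hom) r := by
  simp [coactionOfR, insertLeft]

variable [Preadditive 𝓒] [MonoidalPreadditive 𝓒]

theorem bracket_coaction {D : 𝓒} (hβ : (β_ D D).hom ≫ (β_ D D).hom = 𝟙 _)
    (Q : 𝟙_ 𝓒 ⟶ D ⊗ D) {b r : D ⊗ D ⟶ D}
    (h : D ◁ b ≫ r = (α_ D D D).inv ≫ r ▷ D ≫ b +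
      (α_ D D D).inv ≫ (β_ D D).hom ▷ D ≫ (α_ D D D).hom ≫ D ◁ r ≫ b) :
    b ≫ insertLeft Q r =
      insertLeft Q r ▷ D ≫ mul23 b + comul23 (insertLeft Q r) ≫ braid12 D ≫ mul23 b := by
  have h1 := whiskerLeft_insertLeft hβ Q r
  rw [comp_insertLeft, h, insertLeft_add, insertLeft_whiskerRight, mul23, braid12, comul23]
  congr 1
  · simp [insertLeft_comp]
  · simp only [Category.assoc, reassoc_of% h1, insertLeft_comp]

theorem coaction_cobracket {D : 𝓒} (hβ : (β_ D D).hom ≫ (β_ D D).hom = 𝟙 _)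
    (Q : 𝟙_ 𝓒 ⟶ D ⊗ D) {d : D ⟶ D ⊗ D} {r : D ⊗ D ⟶ D}
    (h : r ≫ d = D ◁ d ≫ (α_ D D D).inv ≫ r ▷ D +
      D ◁ d ≫ (α_ D D D).inv ≫ (β_ D D).hom ▷ D ≫ (α_ D D D).hom ≫ D ◁ r) :
    insertLeft Q r ≫ comul23 d =
      d ≫ insertLeft Q r ▷ D + d ≫ comul23 (insertLeft Q r) ≫ braid12 D := by
  have h1 := whiskerLeft_insertLeft hβ Q r
  rw [insertLeft_whiskerRight, comul23, ← Category.assoc, insertLeft_comp, h, insertLeft_add,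
    ← comp_insertLeft, ← comp_insertLeft, ← h1, Preadditive.add_comp]
  simp [comul23, braid12]

/-- The module law in the second leg: Q₁ ⊗ Q₂·(h·a) = Q₁ ⊗ [Q₂, h]·a + Q₁ ⊗ h·(Q₂·a). -/
theorem act_coaction {D : 𝓒} (hβ : (β_ D D).hom ≫ (β_ D D).hom = 𝟙 _)
    (Q : 𝟙_ 𝓒 ⟶ D ⊗ D) {g r : D ⊗ D ⟶ D} (h : IsModule g r) :
    r ≫ insertLeft Q r = insertLeft Q g ▷ D ≫ mul23 r +
      comul23 (insertLeft Q r) ≫ braid12 D ≫ mul23 r := by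
  have h1 := whiskerLeft_insertLeft hβ Q r
  have h' : D ◁ r ≫ r = ((α_ D D D).inv ≫ g ▷ D) ≫ r +
      ((α_ D D D).inv ≫ (β_ D D).hom ▷ D ≫ (α_ D D D).hom ≫ D ◁ r) ≫ r := by
    rw [Category.assoc, h]
    simp
  rw [comp_insertLeft, h', insertLeft_add, ← insertLeft_comp Q ((α_ D D D).inv ≫ g ▷ D),
    ← insertLeft_comp Q (_ ≫ _ ≫ _ ≫ D ◁ r), ← h1, insertLeft_whiskerRight]
  simp [comul23, braid12, mul23]

end Insertion

/-! ### Consequences of the coboundary condition and of the Yang–Baxter equation -/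

section Quasitriangular

variable {𝓒 : Type u} [Category.{v} 𝓒] [MonoidalCategory 𝓒] [BraidedCategory 𝓒]
  [Preadditive 𝓒] [MonoidalPreadditive 𝓒]

theorem insertRight_bracket_braiding {D : 𝓒} (hβ : (β_ D D).hom ≫ (β_ D D).hom = 𝟙 _)
    (R : 𝟙_ 𝓒 ⟶ D ⊗ D) {g : D ⊗ D ⟶ D} (hg' : (β_ D D).hom ≫ g = -g) :
    (insertRight R ≫ g ▷ D) ≫ (β_ D D).hom = -insertLeft (R ≫ (β_ D D).hom) g := by
  rw [Category.assoc, mul12_braiding, reassoc_of% insertRight_braid23 R,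
    reassoc_of% insertRight_braid12 hβ, braid23_mul23, hg', insertLeft_mul, mul23_neg]
  simp

/-- Co-antisymmetry replaces δ by -Cδ, which turns the coboundary formula for R into one for the
flipped tensor Q, up to sign: δh = Q₁ ⊗ [Q₂, h] - [h, Q₁] ⊗ Q₂. -/
theorem cobracket_eq {D : 𝓒} (hβ : (β_ D D).hom ≫ (β_ D D).hom = 𝟙 _)
    {R : 𝟙_ 𝓒 ⟶ D ⊗ D} {g : D ⊗ D ⟶ D} {e : D ⟶ D ⊗ D} (hg' : (β_ D D).hom ≫ g = -g)
    (he' : e ≫ (β_ D D).hom = -e) (h : Coboundary g e R) :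
    e = insertLeft (R ≫ (β_ D D).hom) g - insertRight (R ≫ (β_ D D).hom) ≫ g ▷ D := by
  have h1 : e = insertRight R ≫ g ▷ D + insertRight R ≫ braid12 D ≫ mul23 g := by
    rw [h]; simp [insertRight, braid12, mul23]
  have s1 := braid12_braid12 hβ
  have h2 : e = -(e ≫ (β_ D D).hom) := by rw [he', neg_neg]
  rw [h2]
  nth_rw 1 [h1]
  rw [Preadditive.add_comp, insertRight_bracket_braiding hβ R hg', Category.assoc, Category.assoc,
    mul23_braiding, reassoc_of% s1, reassoc_of% insertRight_braid23 R]
  abel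

/-- By the coboundary condition [R₁₂, R₂₃] + [R₁₃, R₂₃] = (id ⊗ δ)R, so the Yang–Baxter equation
reads [R₁₂, R₁₃] + (id ⊗ δ)R = 0. -/
theorem CYBE.insert {D : 𝓒} (hβ : (β_ D D).hom ≫ (β_ D D).hom = 𝟙 _)
    {R : 𝟙_ 𝓒 ⟶ D ⊗ D} {g : D ⊗ D ⟶ D} {e : D ⟶ D ⊗ D}
    (hc : CYBE g R) (h : Coboundary g e R) :
    R ≫ (insertRight R ≫ g ▷ D) ▷ D ≫ braid23 D + R ≫ comul23 e = 0 := by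
  have h1 : e = insertRight R ≫ g ▷ D + insertRight R ≫ braid12 D ≫ mul23 g := by
    rw [h]; simp [insertRight, braid12, mul23]
  have t0 := tensor_insert R
  have t1 : (λ_ (𝟙_ 𝓒)).inv ≫ (R ⊗ₘ R) ≫ tensorμ D D D D ≫ g ▷ (D ⊗ D) =
      R ≫ (insertRight R ≫ g ▷ D) ▷ D ≫ braid23 D ≫ (α_ D D D).hom := by
    have : (ρ_ D).inv ≫ D ◁ R ≫ (α_ D D D).inv ≫ (β_ D D).hom ▷ D ≫ (α_ D D D).hom =
        (λ_ D).inv ≫ R ▷ D ≫ (α_ D D D).hom ≫ D ◁ (β_ D D).hom := by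
      have := insertRight_braid12 hβ R =≫ (α_ D D D).hom
      simpa [insertRight, braid12, braid23] using this
    simp only [tensorμ, Category.assoc]
    rw [reassoc_of% t0]
    simp only [← whiskerLeft_comp_assoc, Category.assoc]
    rw [this]
    simp only [insertRight, braid23, comp_whiskerRight, whiskerLeft_comp, Category.assoc,
      Iso.inv_hom_id, Category.comp_id, associator_naturality_left_assoc, ← whisker_exchange]
    monoidal
  have t2 : (λ_ (𝟙_ 𝓒)).inv ≫ (R ⊗ₘ R) ≫
      (α_ D D (D ⊗ D)).hom ≫ D ◁ ((α_ D D D).inv ≫ g ▷ D) =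
      R ≫ D ◁ (insertRight R ≫ g ▷ D) := by
    rw [reassoc_of% t0]
    simp [insertRight]
  have t3 : (λ_ (𝟙_ 𝓒)).inv ≫ (R ⊗ₘ R) ≫ tensorμ D D D D ≫ (D ⊗ D) ◁ g ≫ (α_ D D D).hom =
      R ≫ D ◁ (insertRight R ≫ braid12 D ≫ mul23 g) := by
    simp only [tensorμ, Category.assoc]
    rw [reassoc_of% t0]
    simp [insertRight, braid12, mul23]
  rw [CYBE] at hc
  simp only [Preadditive.comp_add] at hc
  rw [t1, t2, t3, add_assoc, ← Preadditive.comp_add, ← MonoidalPreadditive.whiskerLeft_add,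
    ← h1] at hc
  rw [← cancel_mono (α_ D D D).hom]
  simpa [comul23] using hc

/-- The preceding identity with legs exchanged: (δ ⊗ id)Q = Q₁ ⊗ Q'₁ ⊗ [Q'₂, Q₂]. -/
theorem insert_cobracket {D : 𝓒} (hβ : (β_ D D).hom ≫ (β_ D D).hom = 𝟙 _)
    {R : 𝟙_ 𝓒 ⟶ D ⊗ D} {g : D ⊗ D ⟶ D} {e : D ⟶ D ⊗ D} (hg' : (β_ D D).hom ≫ g = -g)
    (h : Coboundary g e R) (hc : CYBE g R) :
    (R ≫ (β_ D D).hom) ≫ e ▷ D =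
      (R ≫ (β_ D D).hom) ≫ comul23 (insertLeft (R ≫ (β_ D D).hom) g) := by
  have h1 := eq_neg_of_add_eq_zero_right (hc.insert hβ h)
  have s3 := (braid_braid (D := D)).symm
  have h2 : insertLeft (R ≫ (β_ D D).hom) g = -((insertRight R ≫ g ▷ D) ≫ (β_ D D).hom) := by
    rw [insertRight_bracket_braiding hβ R hg', neg_neg]
  rw [Category.assoc, Category.assoc, braiding_comul12, reassoc_of% h1, braiding_comul23, h2,
    whiskerRight_neg, ← comul12_braid12]
  simp only [Preadditive.neg_comp, Preadditive.comp_neg, Category.assoc, s3]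

/-- Let the third leg of (δ ⊗ id)Q act: the module law splits [Q'₂, Q₂]·a into the two iterated
actions, which differ by exchanging the first two legs. -/
theorem coaction_comul {D : 𝓒} (hβ : (β_ D D).hom ≫ (β_ D D).hom = 𝟙 _)
    {R : 𝟙_ 𝓒 ⟶ D ⊗ D} {g r : D ⊗ D ⟶ D} {e : D ⟶ D ⊗ D} (hg' : (β_ D D).hom ≫ g = -g)
    (h : Coboundary g e R) (hc : CYBE g R) (hr : IsModule g r) :
    coactionOfR R r ≫ e ▷ D = coactionOfR R r ≫ comul23 (coactionOfR R r) -
      coactionOfR R r ≫ comul23 (coactionOfR R r) ≫ braid12 D := by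
  rw [coactionOfR_eq, whiskerRight_insertLeft, insert_cobracket hβ hg' h hc, insertLeft_comul]
  set Q := R ≫ (β_ D D).hom
  have h1 := whiskerLeft_insertLeft hβ Q r
  have h2 : insertLeft Q g ▷ D ≫ (α_ D D D).hom ≫ D ◁ r = r ≫ insertLeft Q r -
      comul23 (insertLeft Q r) ≫ braid12 D ≫ mul23 r := by
    rw [act_coaction hβ Q hr, add_sub_cancel_right, mul23]
  have h3 : comul23 (insertLeft Q r) ≫ braid12 D ≫ mul23 r =
      D ◁ insertLeft Q r ≫ (α_ D D D).inv ≫ (β_ D D).hom ▷ D ≫ (α_ D D D).hom ≫ D ◁ r := by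
    simp [comul23, mul23, braid12]
  rw [h2, insertLeft_sub, ← insertLeft_comp, h3, ← comp_insertLeft, ← h1, Preadditive.sub_comp]
  simp [comul23, braid12]

end Quasitriangular

/-! ### Sliding projections and injections through composites -/

section Naturality

variable {𝓒 : Type u} [Category.{v} 𝓒] [MonoidalCategory 𝓒] {D : 𝓒}

section

variable [BraidedCategory 𝓒]

theorem tensorHom_whiskerRight_braiding {X Y Z X' Y' Z' : 𝓒} (f : X ⟶ X') (g : Y ⟶ Y')
    (h : Z ⟶ Z') : ((f ⊗ₘ g) ⊗ₘ h) ≫ (β_ X' Y').hom ▷ Z' =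
      (β_ X Y).hom ▷ Z ≫ ((g ⊗ₘ f) ⊗ₘ h) := by
  simp only [← tensorHom_id, tensorHom_comp_tensorHom, BraidedCategory.braiding_naturality,
    Category.comp_id, Category.id_comp]

theorem tensorHom_whiskerLeft_braiding {X Y Z X' Y' Z' : 𝓒} (f : X ⟶ X') (g : Y ⟶ Y')
    (h : Z ⟶ Z') : (f ⊗ₘ (g ⊗ₘ h)) ≫ X' ◁ (β_ Y' Z').hom =
      X ◁ (β_ Y Z).hom ≫ (f ⊗ₘ (h ⊗ₘ g)) := by
  simp only [← id_tensorHom, tensorHom_comp_tensorHom, BraidedCategory.braiding_naturality,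
    Category.comp_id, Category.id_comp]

theorem tensorHom_braid12 {X Y : 𝓒} (f : X ⟶ Y) :
    ((f ⊗ₘ f) ⊗ₘ f) ≫ braid12 Y = braid12 X ≫ ((f ⊗ₘ f) ⊗ₘ f) :=
  tensorHom_whiskerRight_braiding f f f

theorem tensorHom_braid23 {X Y : 𝓒} (f : X ⟶ Y) :
    ((f ⊗ₘ f) ⊗ₘ f) ≫ braid23 Y = braid23 X ≫ ((f ⊗ₘ f) ⊗ₘ f) := by
  have := tensorHom_whiskerLeft_braiding f f f
  simp only [braid23, Category.assoc, associator_naturality_assoc, reassoc_of% this,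
    associator_inv_naturality]

end

variable {P L L₁ L₂ M M' N : 𝓒}

section
variable {N': 𝓒} (a : D ⟶ M) (b : D ⟶ M') (c : D ⟶ L) (m : M ⊗ M' ⟶ N) (k : N ⟶ D)
  (u : D ⟶ N)

theorem whiskerRight_mul_transport (h : k ≫ u = 𝟙 N) (n : N ⊗ L ⟶ N') :
    ((a ⊗ₘ b) ≫ m ≫ k) ▷ D ≫ (u ⊗ₘ c) ≫ n = ((a ⊗ₘ b) ⊗ₘ c) ≫ m ▷ L ≫ n := by
  simp only [← tensorHom_id, tensorHom_comp_tensorHom_assoc, Category.assoc, h,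
    Category.comp_id, Category.id_comp]

theorem whiskerLeft_mul_transport (h : k ≫ u = 𝟙 N) (n : L ⊗ N ⟶ N') :
    D ◁ ((a ⊗ₘ b) ≫ m ≫ k) ≫ (c ⊗ₘ u) ≫ n = (c ⊗ₘ (a ⊗ₘ b)) ≫ L ◁ m ≫ n := by
  simp only [← id_tensorHom, tensorHom_comp_tensorHom_assoc, Category.assoc, h,
    Category.comp_id, Category.id_comp]

end

section
variable (u : D ⟶ M) (a : D ⟶ L₁) (b : D ⟶ L₂) (p : P ⟶ L) (x : L₁ ⟶ D) (y : L₂ ⟶ D) (k : N ⟶ D)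
  (c : L ⟶ L₁ ⊗ L₂) (m : M ⊗ L₁ ⟶ N) (n : M ⊗ L₂ ⟶ N) (m' : L₁ ⊗ M ⟶ N) (n' : L₂ ⊗ M ⟶ N)

/-- Only the leg of `c` entering `m` is injected into D and projected back, which cancels; the other
maps slide to the ends by naturality. The three variants that follow differ in which legs meet. -/
theorem whiskerLeft_comp_whiskerRight_transport (h : x ≫ a = 𝟙 L₁) :
    D ◁ (p ≫ c ≫ (x ⊗ₘ y)) ≫ (α_ D D D).inv ≫ ((u ⊗ₘ a) ≫ m ≫ k) ▷ D =
      (u ⊗ₘ p) ≫ M ◁ c ≫ (α_ M L₁ L₂).inv ≫ m ▷ L₂ ≫ (k ⊗ₘ y) := by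
  have e1 : (u ⊗ₘ p) ≫ M ◁ c = D ◁ (p ≫ c) ≫ (u ⊗ₘ (𝟙 L₁ ⊗ₘ 𝟙 L₂)) := by
    simp only [← id_tensorHom, tensorHom_comp_tensorHom, id_tensorHom_id, Category.comp_id,
      Category.id_comp]
  rw [reassoc_of% e1, ← Category.assoc p, whiskerLeft_comp, Category.assoc]
  simp only [← id_tensorHom _ (x ⊗ₘ y), ← tensorHom_id, associator_inv_naturality_assoc,
    tensorHom_comp_tensorHom, tensorHom_comp_tensorHom_assoc, Category.comp_id, Category.id_comp,
    h]

theorem whiskerRight_comp_whiskerLeft_transport (h : y ≫ b = 𝟙 L₂) :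
    (p ≫ c ≫ (x ⊗ₘ y)) ▷ D ≫ (α_ D D D).hom ≫ D ◁ ((b ⊗ₘ u) ≫ n' ≫ k) =
      (p ⊗ₘ u) ≫ c ▷ M ≫ (α_ L₁ L₂ M).hom ≫ L₁ ◁ n' ≫ (x ⊗ₘ k) := by
  have e1 : (p ⊗ₘ u) ≫ c ▷ M = (p ≫ c) ▷ D ≫ ((𝟙 L₁ ⊗ₘ 𝟙 L₂) ⊗ₘ u) := by
    simp only [← tensorHom_id, tensorHom_comp_tensorHom, id_tensorHom_id, Category.comp_id,
      Category.id_comp]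
  rw [reassoc_of% e1, ← Category.assoc p, comp_whiskerRight, Category.assoc]
  simp only [← tensorHom_id (x ⊗ₘ y), ← id_tensorHom, associator_naturality_assoc,
    tensorHom_comp_tensorHom, tensorHom_comp_tensorHom_assoc, Category.comp_id, Category.id_comp,
    h]

variable [BraidedCategory 𝓒]

theorem whiskerLeft_comp_whiskerLeft_transport (h : y ≫ b = 𝟙 L₂) :
    D ◁ (p ≫ c ≫ (x ⊗ₘ y)) ≫ (α_ D D D).inv ≫ (β_ D D).hom ▷ D ≫ (α_ D D D).hom ≫
        D ◁ ((u ⊗ₘ b) ≫ n ≫ k) =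
      (u ⊗ₘ p) ≫ M ◁ c ≫ (α_ M L₁ L₂).inv ≫ (β_ M L₁).hom ▷ L₂ ≫ (α_ L₁ M L₂).hom ≫
        L₁ ◁ n ≫ (x ⊗ₘ k) := by
  have e1 : (u ⊗ₘ p) ≫ M ◁ c = D ◁ (p ≫ c) ≫ (u ⊗ₘ (𝟙 L₁ ⊗ₘ 𝟙 L₂)) := by
    simp only [← id_tensorHom, tensorHom_comp_tensorHom, id_tensorHom_id, Category.comp_id,
      Category.id_comp]
  have e2 := tensorHom_whiskerRight_braiding u (𝟙 L₁) (𝟙 L₂)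
  have e3 := tensorHom_whiskerRight_braiding (𝟙 D) x y
  rw [reassoc_of% e1, ← Category.assoc p, whiskerLeft_comp, Category.assoc]
  simp only [← id_tensorHom _ (x ⊗ₘ y), ← id_tensorHom _ n, ← id_tensorHom _ ((u ⊗ₘ b) ≫ n ≫ k),
    associator_inv_naturality_assoc, reassoc_of% e2, reassoc_of% e3, associator_naturality_assoc,
    tensorHom_comp_tensorHom, tensorHom_comp_tensorHom_assoc, Category.comp_id, Category.id_comp,
    h]

theorem whiskerRight_comp_whiskerRight_transport (h : x ≫ a = 𝟙 L₁) :
    (p ≫ c ≫ (x ⊗ₘ y)) ▷ D ≫ (α_ D D D).hom ≫ D ◁ (β_ D D).hom ≫ (α_ D D D).inv ≫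
        ((a ⊗ₘ u) ≫ m' ≫ k) ▷ D =
      (p ⊗ₘ u) ≫ c ▷ M ≫ (α_ L₁ L₂ M).hom ≫ L₁ ◁ (β_ L₂ M).hom ≫ (α_ L₁ M L₂).inv ≫
        m' ▷ L₂ ≫ (k ⊗ₘ y) := by
  have e1 : (p ⊗ₘ u) ≫ c ▷ M = (p ≫ c) ▷ D ≫ ((𝟙 L₁ ⊗ₘ 𝟙 L₂) ⊗ₘ u) := by
    simp only [← tensorHom_id, tensorHom_comp_tensorHom, id_tensorHom_id, Category.comp_id,
      Category.id_comp]
  have e2 := tensorHom_whiskerLeft_braiding (𝟙 L₁) (𝟙 L₂) u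
  have e3 := tensorHom_whiskerLeft_braiding x y (𝟙 D)
  rw [reassoc_of% e1, ← Category.assoc p, comp_whiskerRight, Category.assoc]
  simp only [← tensorHom_id (x ⊗ₘ y), ← tensorHom_id m', ← tensorHom_id ((a ⊗ₘ u) ≫ m' ≫ k),
    associator_inv_naturality_assoc, reassoc_of% e2, reassoc_of% e3, associator_naturality_assoc,
    tensorHom_comp_tensorHom, tensorHom_comp_tensorHom_assoc, Category.comp_id, Category.id_comp,
    h]

end


end Naturality

/-! ### Extending the structures on A and H by zero to D -/

section Transport

variable {𝓒 : Type u} [Category.{v} 𝓒] [MonoidalCategory 𝓒] [BraidedCategory 𝓒]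
  {A H D : 𝓒}

theorem SymmetricOn.braiding_comp_braiding {E : Set 𝓒} (h : SymmetricOn E) {U V : 𝓒}
    (hU : U ∈ E) (hV : V ∈ E) : (β_ U V).hom ≫ (β_ V U).hom = 𝟙 _ := by
  rw [h U hU V hV, Iso.inv_hom_id]

theorem symmetricOn_singleton (h : (β_ D D).hom ≫ (β_ D D).hom = 𝟙 _) :
    SymmetricOn ({D} : Set 𝓒) := by
  intro U hU V hV
  obtain rfl : U = D := hU
  obtain rfl : V = U := hV
  rw [← cancel_mono (β_ V V).hom, h, Iso.inv_hom_id]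

theorem coactionOfR_transport {act : H ⊗ A ⟶ A} {R : 𝟙_ 𝓒 ⟶ H ⊗ H} (p : D ⟶ A) (q : D ⟶ H)
    (i : A ⟶ D) (j : H ⟶ D) (hj : j ≫ q = 𝟙 H) :
    coactionOfR (R ≫ (j ⊗ₘ j)) ((q ⊗ₘ p) ≫ act ≫ i) = p ≫ coactionOfR R act ≫ (j ⊗ₘ i) := by
  have e1 : p ≫ (λ_ A).inv ≫ R ▷ A = (λ_ D).inv ≫ R ▷ D ≫ ((𝟙 H ⊗ₘ 𝟙 H) ⊗ₘ p) := by
    rw [leftUnitor_inv_naturality_assoc, whisker_exchange, id_tensorHom_id, id_tensorHom]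
  have e2 := tensorHom_whiskerRight_braiding (𝟙 H) (𝟙 H) p
  have e3 := tensorHom_whiskerRight_braiding j j (𝟙 D)
  simp only [coactionOfR, Category.assoc, reassoc_of% e1, reassoc_of% e2]
  rw [comp_whiskerRight, ← tensorHom_id (j ⊗ₘ j)]
  simp only [Category.assoc, reassoc_of% e3, associator_naturality_assoc, ← id_tensorHom,
    tensorHom_comp_tensorHom, tensorHom_comp_tensorHom_assoc, Category.comp_id, Category.id_comp,
    hj]

variable [Preadditive 𝓒]

section

variable [MonoidalPreadditive 𝓒]

/-- Cut the identity of D ⊗ D into its four summands; on each one naturality moves C² to a pair from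
{A, H}. -/
theorem braiding_comp_braiding_of_split (hs : SymmetricOn ({A, H} : Set 𝓒)) (p : D ⟶ A) (q : D ⟶ H)
    (i : A ⟶ D) (j : H ⟶ D) (h : p ≫ i + q ≫ j = 𝟙 D) :
    (β_ D D).hom ≫ (β_ D D).hom = 𝟙 _ := by
  have hAA := hs.braiding_comp_braiding (U := A) (V := A) (by simp) (by simp)
  have hAH := hs.braiding_comp_braiding (U := A) (V := H) (by simp) (by simp)
  have hHA := hs.braiding_comp_braiding (U := H) (V := A) (by simp) (by simp)
  have hHH := hs.braiding_comp_braiding (U := H) (V := H) (by simp) (by simp)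
  have h1 : 𝟙 (D ⊗ D) = (p ⊗ₘ p) ≫ (i ⊗ₘ i) + (p ⊗ₘ q) ≫ (i ⊗ₘ j) +
      ((q ⊗ₘ p) ≫ (j ⊗ₘ i) + (q ⊗ₘ q) ≫ (j ⊗ₘ j)) := by
    simp only [tensorHom_comp_tensorHom, ← MonoidalPreadditive.tensor_add,
      ← MonoidalPreadditive.add_tensor, h, id_tensorHom_id]
  rw [← Category.id_comp (_ ≫ _), h1]
  simp only [Preadditive.add_comp, Category.assoc, BraidedCategory.braiding_naturality,
    BraidedCategory.braiding_naturality_assoc, reassoc_of% hAA, reassoc_of% hAH,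
    reassoc_of% hHA, reassoc_of% hHH]

end

theorem IsLieAlgebra.transport {L : 𝓒} {m : L ⊗ L ⟶ L} (hm : IsLieAlgebra L m)
    (hβ : (β_ D D).hom ≫ (β_ D D).hom = 𝟙 _) (p : D ⟶ L) (i : L ⟶ D) (h : i ≫ p = 𝟙 L) :
    IsLieAlgebra D ((p ⊗ₘ p) ≫ m ≫ i) where
  symmetric := symmetricOn_singleton hβ
  antisymm := by
    have := (p ⊗ₘ p) ≫= hm.antisymm =≫ i
    simpa using this
  jacobi := by
    have h1 : ((p ⊗ₘ p) ≫ m ≫ i) ▷ D ≫ (p ⊗ₘ p) ≫ m ≫ i = ((p ⊗ₘ p) ⊗ₘ p) ≫ m ▷ L ≫ m ≫ i := by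
      simp only [← tensorHom_id, tensorHom_comp_tensorHom_assoc, Category.assoc, h,
        Category.comp_id, Category.id_comp]
    have h2 := tensorHom_braid12 p
    have h3 := tensorHom_braid23 p
    have := ((p ⊗ₘ p) ⊗ₘ p) ≫= hm.jacobi =≫ i
    simp only [Preadditive.add_comp, Preadditive.comp_add, Category.assoc, Category.id_comp,
      comp_zero, zero_comp] at this
    simp only [Preadditive.add_comp, Category.assoc, Category.id_comp, h1, ← reassoc_of% h2,
      ← reassoc_of% h3, this]

theorem IsLieCoalgebra.transport {L : 𝓒} {c : L ⟶ L ⊗ L} (hc : IsLieCoalgebra L c)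
    (hβ : (β_ D D).hom ≫ (β_ D D).hom = 𝟙 _) (p : D ⟶ L) (i : L ⟶ D) (h : i ≫ p = 𝟙 L) :
    IsLieCoalgebra D (p ≫ c ≫ (i ⊗ₘ i)) where
  symmetric := symmetricOn_singleton hβ
  coantisymm := by
    have := p ≫= hc.coantisymm =≫ (i ⊗ₘ i)
    simp only [Preadditive.add_comp, Preadditive.comp_add, Category.assoc, Category.comp_id,
      comp_zero, zero_comp] at this
    simp only [Preadditive.comp_add, Category.assoc, Category.comp_id,
      BraidedCategory.braiding_naturality, this]
  cojacobi := by
    have h1 : (p ≫ c ≫ (i ⊗ₘ i)) ≫ (p ≫ c ≫ (i ⊗ₘ i)) ▷ D =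
        p ≫ c ≫ c ▷ L ≫ ((i ⊗ₘ i) ⊗ₘ i) := by
      simp only [← tensorHom_id, tensorHom_comp_tensorHom, Category.assoc, reassoc_of% h,
        Category.comp_id, Category.id_comp]
    have h2 := tensorHom_braid12 i
    have h3 := tensorHom_braid23 i
    have := p ≫= hc.cojacobi =≫ ((i ⊗ₘ i) ⊗ₘ i)
    simp only [Preadditive.add_comp, Preadditive.comp_add, Category.assoc, Category.comp_id,
      comp_zero, zero_comp] at this
    rw [← Category.assoc, h1]
    simp only [Preadditive.comp_add, Category.assoc, Category.comp_id, h2,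
      h3, reassoc_of% h2, reassoc_of% h3, this]


variable {brA : A ⊗ A ⟶ A} {brH : H ⊗ H ⟶ H} {δA : A ⟶ A ⊗ A} {δH : H ⟶ H ⊗ H}
  {act : H ⊗ A ⟶ A} {R : 𝟙_ 𝓒 ⟶ H ⊗ H} (p : D ⟶ A) (q : D ⟶ H) (i : A ⟶ D) (j : H ⟶ D)

theorem IsModule.transport (h : IsModule brH act) (hi : i ≫ p = 𝟙 A) (hj : j ≫ q = 𝟙 H) :
    IsModule ((q ⊗ₘ q) ≫ brH ≫ j) ((q ⊗ₘ p) ≫ act ≫ i) := by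
  have := ((q ⊗ₘ q) ⊗ₘ p) ≫= h =≫ i
  have e := tensorHom_whiskerRight_braiding q q p
  simp only [Category.assoc, associator_naturality_assoc, reassoc_of% e, Preadditive.comp_sub,
    Preadditive.sub_comp] at this
  simpa only [IsModule, whiskerRight_mul_transport _ _ _ _ _ _ hj,
    whiskerLeft_mul_transport _ _ _ _ _ _ hi] using this

theorem act_bracket_transport
    (h : H ◁ brA ≫ act = (α_ H A A).inv ≫ act ▷ A ≫ brA +
      (α_ H A A).inv ≫ (β_ H A).hom ▷ A ≫ (α_ A H A).hom ≫ A ◁ act ≫ brA)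
    (hi : i ≫ p = 𝟙 A) :
    D ◁ ((p ⊗ₘ p) ≫ brA ≫ i) ≫ (q ⊗ₘ p) ≫ act ≫ i =
      (α_ D D D).inv ≫ ((q ⊗ₘ p) ≫ act ≫ i) ▷ D ≫ (p ⊗ₘ p) ≫ brA ≫ i +
      (α_ D D D).inv ≫ (β_ D D).hom ▷ D ≫ (α_ D D D).hom ≫ D ◁ ((q ⊗ₘ p) ≫ act ≫ i) ≫
        (p ⊗ₘ p) ≫ brA ≫ i := by
  have := (q ⊗ₘ (p ⊗ₘ p)) ≫= h =≫ i
  have e := tensorHom_whiskerRight_braiding q p p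
  simp only [Category.assoc, associator_naturality_assoc, associator_inv_naturality_assoc,
    reassoc_of% e, Preadditive.comp_add, Preadditive.add_comp] at this
  simpa only [whiskerRight_mul_transport _ _ _ _ _ _ hi,
    whiskerLeft_mul_transport _ _ _ _ _ _ hi] using this

theorem act_cobracket_transport
    (h : act ≫ δA = H ◁ δA ≫ (α_ H A A).inv ≫ act ▷ A +
      H ◁ δA ≫ (α_ H A A).inv ≫ (β_ H A).hom ▷ A ≫ (α_ A H A).hom ≫ A ◁ act)
    (hi : i ≫ p = 𝟙 A) :
    ((q ⊗ₘ p) ≫ act ≫ i) ≫ p ≫ δA ≫ (i ⊗ₘ i) =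
      D ◁ (p ≫ δA ≫ (i ⊗ₘ i)) ≫ (α_ D D D).inv ≫ ((q ⊗ₘ p) ≫ act ≫ i) ▷ D +
      D ◁ (p ≫ δA ≫ (i ⊗ₘ i)) ≫ (α_ D D D).inv ≫ (β_ D D).hom ▷ D ≫ (α_ D D D).hom ≫
        D ◁ ((q ⊗ₘ p) ≫ act ≫ i) := by
  rw [whiskerLeft_comp_whiskerRight_transport _ _ _ _ _ _ _ _ hi,
    whiskerLeft_comp_whiskerLeft_transport _ _ _ _ _ _ _ _ hi]
  have := (q ⊗ₘ p) ≫= h =≫ (i ⊗ₘ i)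
  simpa only [Category.assoc, Preadditive.comp_add, Preadditive.add_comp, reassoc_of% hi]
    using this

theorem adCobracket_transport {L : 𝓒} (m : L ⊗ L ⟶ L) (c : L ⟶ L ⊗ L) (p : D ⟶ L) (i : L ⟶ D)
    (h : i ≫ p = 𝟙 L) :
    adCobracket ((p ⊗ₘ p) ≫ m ≫ i) (p ≫ c ≫ (i ⊗ₘ i)) =
      (p ⊗ₘ p) ≫ adCobracket m c ≫ (i ⊗ₘ i) := by
  rw [adCobracket, whiskerLeft_comp_whiskerRight_transport _ _ _ _ _ _ _ _ h,
    whiskerLeft_comp_whiskerLeft_transport _ _ _ _ _ _ _ _ h, adCobracket]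
  simp only [Category.assoc, Preadditive.comp_add, Preadditive.add_comp]

theorem IsLieBialgebra.cocycle_transport {L : 𝓒} {m : L ⊗ L ⟶ L} {c : L ⟶ L ⊗ L}
    (hL : IsLieBialgebra L m c) (p : D ⟶ L) (i : L ⟶ D) (h : i ≫ p = 𝟙 L) :
    ((p ⊗ₘ p) ≫ m ≫ i) ≫ p ≫ c ≫ (i ⊗ₘ i) = (𝟙 (D ⊗ D) - (β_ D D).hom) ≫
      adCobracket ((p ⊗ₘ p) ≫ m ≫ i) (p ≫ c ≫ (i ⊗ₘ i)) := by
  have := (p ⊗ₘ p) ≫= hL.cocycle =≫ (i ⊗ₘ i)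
  rw [adCobracket_transport _ _ _ _ h]
  simpa only [Category.assoc, Preadditive.comp_sub, Preadditive.sub_comp, reassoc_of% h,
    Category.id_comp, BraidedCategory.braiding_naturality_assoc] using this

/-- The fourth summand is the first followed by C, so each summand has a shape covered by the
sliding lemmas. -/
theorem infBraiding_eq (φ : A ⟶ H ⊗ A) :
    infBraiding act φ =
      A ◁ φ ≫ (α_ A H A).inv ≫ ((β_ A H).hom ≫ act) ▷ A +
      (φ ≫ (β_ H A).hom) ▷ A ≫ (α_ A H A).hom ≫ A ◁ act -
      φ ▷ A ≫ (α_ H A A).hom ≫ H ◁ (β_ A A).hom ≫ (α_ H A A).inv ≫ act ▷ A -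
      A ◁ φ ≫ (α_ A H A).inv ≫ ((β_ A H).hom ≫ act) ▷ A ≫ (β_ A A).hom := by
  simp [infBraiding, BraidedCategory.braiding_naturality_left,
    BraidedCategory.braiding_tensor_left_hom]

theorem infBraiding_transport (φ : A ⟶ H ⊗ A) (hj : j ≫ q = 𝟙 H) :
    infBraiding ((q ⊗ₘ p) ≫ act ≫ i) (p ≫ φ ≫ (j ⊗ₘ i)) =
      (p ⊗ₘ p) ≫ infBraiding act φ ≫ (i ⊗ₘ i) := by
  have e1 : (β_ D D).hom ≫ (q ⊗ₘ p) ≫ act ≫ i = (p ⊗ₘ q) ≫ ((β_ A H).hom ≫ act) ≫ i := by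
    simp
  have e2 : (p ≫ φ ≫ (j ⊗ₘ i)) ≫ (β_ D D).hom = p ≫ (φ ≫ (β_ H A).hom) ≫ (i ⊗ₘ j) := by
    simp
  have e3 := whiskerLeft_comp_whiskerRight_transport p q p j i i φ ((β_ A H).hom ≫ act) hj
  rw [infBraiding_eq, infBraiding_eq, e1, e2]
  generalize (β_ A H).hom ≫ act = m at e3 ⊢
  rw [reassoc_of% e3, e3,
    whiskerRight_comp_whiskerLeft_transport _ _ _ _ _ _ _ _ hj,
    whiskerRight_comp_whiskerRight_transport _ _ _ _ _ _ _ _ hj]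
  simp only [Category.assoc, Preadditive.comp_add, Preadditive.add_comp, Preadditive.comp_sub,
    Preadditive.sub_comp, BraidedCategory.braiding_naturality]

theorem SLB.transport {φ : A ⟶ H ⊗ A} (h : SLB brA δA act φ) (hi : i ≫ p = 𝟙 A)
    (hj : j ≫ q = 𝟙 H) :
    SLB ((p ⊗ₘ p) ≫ brA ≫ i) (p ≫ δA ≫ (i ⊗ₘ i)) ((q ⊗ₘ p) ≫ act ≫ i)
      (p ≫ φ ≫ (j ⊗ₘ i)) := by
  have := (p ⊗ₘ p) ≫= h =≫ (i ⊗ₘ i)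
  rw [SLB, adCobracket_transport _ _ _ _ hi, infBraiding_transport _ _ _ _ _ hj]
  simpa only [Category.assoc, Preadditive.comp_sub, Preadditive.sub_comp, reassoc_of% hi,
    Category.id_comp, BraidedCategory.braiding_naturality_assoc] using this

theorem Coboundary.transport (h : Coboundary brH δH R) (hj : j ≫ q = 𝟙 H) :
    Coboundary ((q ⊗ₘ q) ≫ brH ≫ j) (q ≫ δH ≫ (j ⊗ₘ j)) (R ≫ (j ⊗ₘ j)) := by
  have := q ≫= h =≫ (j ⊗ₘ j)
  have e1 := whiskerLeft_comp_whiskerRight_transport q q (𝟙 (𝟙_ 𝓒)) j j j R brH hj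
  have e2 := whiskerLeft_comp_whiskerLeft_transport q q (𝟙 (𝟙_ 𝓒)) j j j R brH hj
  rw [Category.id_comp] at e1 e2
  rw [Coboundary]
  simp only [Preadditive.comp_add, Preadditive.add_comp, Category.assoc] at this ⊢
  rw [this, e1, e2]
  simp only [tensorHom_id, rightUnitor_inv_naturality_assoc]

theorem CYBE.transport (h : CYBE brH R) (hj : j ≫ q = 𝟙 H) :
    CYBE ((q ⊗ₘ q) ≫ brH ≫ j) (R ≫ (j ⊗ₘ j)) := by
  have := h =≫ (j ⊗ₘ (j ⊗ₘ j))
  rw [CYBE]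
  have e0 : ((R ≫ (j ⊗ₘ j)) ⊗ₘ (R ≫ (j ⊗ₘ j))) = (R ⊗ₘ R) ≫ ((j ⊗ₘ j) ⊗ₘ (j ⊗ₘ j)) := by
    rw [tensorHom_comp_tensorHom]
  have e1 := tensorμ_natural j j j j
  simp only [Preadditive.comp_add, Preadditive.add_comp, Category.assoc, zero_comp,
    ← associator_naturality] at this ⊢
  rw [e0]
  simp only [Category.assoc, reassoc_of% e1]
  simp only [← id_tensorHom, ← tensorHom_id, associator_naturality_assoc,
    associator_inv_naturality_assoc, tensorHom_comp_tensorHom,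
    tensorHom_comp_tensorHom_assoc, id_tensorHom_id, Category.assoc, Category.comp_id,
    Category.id_comp, hj] at this ⊢
  exact this

end Transport

/-! ### Composites with mismatched summands -/

section Vanishing

variable {𝓒 : Type u} [Category.{v} 𝓒] [MonoidalCategory 𝓒]
  [Preadditive 𝓒] [MonoidalPreadditive 𝓒] {D X : 𝓒}

/-- The product sees its right input only through `a`, which kills the leg of `c` fed into it. -/
theorem comul23_mul12_eq_zero {c : D ⟶ D ⊗ D} {m : D ⊗ D ⟶ D} (a : D ⟶ X) (n : D ⊗ X ⟶ D)
    (hc : c ≫ a ▷ D = 0) (hm : m = D ◁ a ≫ n) : comul23 c ≫ m ▷ D = 0 := by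
  have : D ◁ c ≫ (α_ D D D).inv ≫ (D ◁ a) ▷ D = D ◁ (c ≫ a ▷ D) ≫ (α_ D X D).inv := by simp
  rw [hm, comul23, comp_whiskerRight, Category.assoc, reassoc_of% this, hc]
  simp

theorem comul23_braid12_mul23_eq_zero [BraidedCategory 𝓒] {c : D ⟶ D ⊗ D} {m : D ⊗ D ⟶ D} (a : D ⟶ X)
    (n : D ⊗ X ⟶ D) (hc : c ≫ D ◁ a = 0) (hm : m = D ◁ a ≫ n) :
    comul23 c ≫ braid12 D ≫ mul23 m = 0 := by
  have : D ◁ c ≫ (α_ D D D).inv ≫ (β_ D D).hom ▷ D ≫ (α_ D D D).hom ≫ D ◁ D ◁ a =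
      D ◁ (c ≫ D ◁ a) ≫ (α_ D D X).inv ≫ (β_ D D).hom ▷ X ≫ (α_ D D X).hom := by
    simp only [← associator_naturality_right, ← whisker_exchange_assoc, whiskerLeft_comp,
      Category.assoc, associator_inv_naturality_right_assoc]
  rw [hm, comul23, braid12, mul23, whiskerLeft_comp, Category.assoc, reassoc_of% this, hc]
  simp

end Vanishing

/-! ### Assembly of the bialgebra on D -/

section Main

variable {𝓒 : Type u} [Category.{v} 𝓒] [MonoidalCategory 𝓒] [BraidedCategory 𝓒]
  [Preadditive 𝓒]

theorem IsLieAlgebra.braiding_comp {L : 𝓒} {m : L ⊗ L ⟶ L} (h : IsLieAlgebra L m) :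
    (β_ L L).hom ≫ m = -m := by
  have := h.antisymm
  rw [Preadditive.add_comp, Category.id_comp] at this
  exact eq_neg_of_add_eq_zero_right this

theorem IsLieCoalgebra.comp_braiding {L : 𝓒} {c : L ⟶ L ⊗ L} (h : IsLieCoalgebra L c) :
    c ≫ (β_ L L).hom = -c := by
  have := h.coantisymm
  rw [Preadditive.comp_add, Category.comp_id] at this
  exact eq_neg_of_add_eq_zero_right this

theorem antisymm_of_split {D : 𝓒} (hβ : (β_ D D).hom ≫ (β_ D D).hom = 𝟙 _) {b g r : D ⊗ D ⟶ D}
    (hb : (β_ D D).hom ≫ b = -b) (hg : (β_ D D).hom ≫ g = -g) :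
    (𝟙 (D ⊗ D) + (β_ D D).hom) ≫ (b + r - (β_ D D).hom ≫ r + g) = 0 := by
  simp only [Preadditive.add_comp, Preadditive.comp_add, Preadditive.comp_sub, Category.id_comp,
    hb, hg, reassoc_of% hβ]
  abel

theorem coantisymm_of_split {D : 𝓒} (hβ : (β_ D D).hom ≫ (β_ D D).hom = 𝟙 _)
    {d e φ : D ⟶ D ⊗ D} (hd : d ≫ (β_ D D).hom = -d) (he : e ≫ (β_ D D).hom = -e) :
    (d + φ - φ ≫ (β_ D D).hom + e) ≫ (𝟙 (D ⊗ D) + (β_ D D).hom) = 0 := by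
  simp only [Preadditive.add_comp, Preadditive.comp_add, Preadditive.sub_comp, Category.comp_id,
    Category.assoc, hd, he, hβ]
  abel

variable [MonoidalPreadditive 𝓒]

/-- Only the splitting identities of the biproduct matter, so D is any object split by A and H. -/
theorem isLieBialgebra_of_split {A H D : 𝓒} (hsymm : SymmetricOn ({A, H} : Set 𝓒))
    {brH : H ⊗ H ⟶ H} {δH : H ⟶ H ⊗ H} {R : 𝟙_ 𝓒 ⟶ H ⊗ H}
    (hH : IsQuasitriangular H brH δH R)
    {brA : A ⊗ A ⟶ A} {δA : A ⟶ A ⊗ A} {act : H ⊗ A ⟶ A}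
    (hA : IsModuleLieAlgebra brH brA act) (hA' : IsModuleLieCoalgebra brH δA act)
    (hSLB : SLB brA δA act (coactionOfR R act))
    (p : D ⟶ A) (q : D ⟶ H) (i : A ⟶ D) (j : H ⟶ D)
    (hip : i ≫ p = 𝟙 A) (hjq : j ≫ q = 𝟙 H) (hiq : i ≫ q = 0) (hjp : j ≫ p = 0)
    (hD : p ≫ i + q ≫ j = 𝟙 D)
    {b g r : D ⊗ D ⟶ D} {d e φ : D ⟶ D ⊗ D}
    (hb : b = (p ⊗ₘ p) ≫ brA ≫ i) (hg : g = (q ⊗ₘ q) ≫ brH ≫ j) (hr : r = (q ⊗ₘ p) ≫ act ≫ i)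
    (hd : d = p ≫ δA ≫ (i ⊗ₘ i)) (he : e = q ≫ δH ≫ (j ⊗ₘ j))
    (hφ : φ = p ≫ coactionOfR R act ≫ (j ⊗ₘ i)) :
    IsLieBialgebra D (b + r - (β_ D D).hom ≫ r + g) (d + φ - φ ≫ (β_ D D).hom + e) := by
  have hβ := braiding_comp_braiding_of_split hsymm p q i j hD
  have Lb : IsLieAlgebra D b := hb ▸ hA.lieAlgebra.transport hβ p i hip
  have Lg : IsLieAlgebra D g := hg ▸ hH.lieBialgebra.lieAlgebra.transport hβ q j hjq
  have Ld : IsLieCoalgebra D d := hd ▸ hA'.lieCoalgebra.transport hβ p i hip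
  have Le : IsLieCoalgebra D e := he ▸ hH.lieBialgebra.lieCoalgebra.transport hβ q j hjq
  have hmod : IsModule g r := by
    rw [hg, hr]; exact hA.isModule.transport p q i j hip hjq
  have hbr : D ◁ b ≫ r = (α_ D D D).inv ≫ r ▷ D ≫ b +
      (α_ D D D).inv ≫ (β_ D D).hom ▷ D ≫ (α_ D D D).hom ≫ D ◁ r ≫ b := by
    rw [hb, hr]; exact act_bracket_transport p q i hA.act_bracket hip
  have hcobr : r ≫ d = D ◁ d ≫ (α_ D D D).inv ≫ r ▷ D +
      D ◁ d ≫ (α_ D D D).inv ≫ (β_ D D).hom ▷ D ≫ (α_ D D D).hom ≫ D ◁ r := by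
    rw [hd, hr]; exact act_cobracket_transport p q i hA'.act_cobracket hip
  have hcoc : g ≫ e = (𝟙 (D ⊗ D) - (β_ D D).hom) ≫ adCobracket g e := by
    rw [hg, he]; exact hH.lieBialgebra.cocycle_transport q j hjq
  have hslb : SLB b d r φ := by
    rw [hb, hd, hr, hφ]; exact hSLB.transport p q i j hip hjq
  have hφ' : φ = coactionOfR (R ≫ (j ⊗ₘ j)) r := by
    rw [hφ, hr, coactionOfR_transport p q i j hjq]
  have hcob : Coboundary g e (R ≫ (j ⊗ₘ j)) := by
    rw [hg, he]; exact hH.coboundary.transport q j hjq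
  have hcybe : CYBE g (R ≫ (j ⊗ₘ j)) := by
    rw [hg]; exact hH.cybe.transport q j hjq
  have hbφ : b ≫ φ = φ ▷ D ≫ mul23 b + comul23 φ ≫ braid12 D ≫ mul23 b := by
    rw [hφ', coactionOfR_eq]; exact bracket_coaction hβ _ hbr
  have hφd : φ ≫ comul23 d = d ≫ φ ▷ D + d ≫ comul23 φ ≫ braid12 D := by
    rw [hφ', coactionOfR_eq]; exact coaction_cobracket hβ _ hcobr
  have hφe : φ ≫ e ▷ D = φ ≫ comul23 φ - φ ≫ comul23 φ ≫ braid12 D := by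
    rw [hφ']; exact coaction_comul hβ Lg.braiding_comp hcob hcybe hmod
  -- Q₁ ⊗ [Q₂, h]·a from the module law is h₁ ⊗ h₂·a + [h, Q₁] ⊗ Q₂·a by the coboundary formula for
  -- Q.
  have hrφ : r ≫ φ = comul23 φ ≫ g ▷ D + comul23 φ ≫ braid12 D ≫ mul23 r + e ▷ D ≫ mul23 r := by
    rw [hφ', coactionOfR_eq, act_coaction hβ _ hmod,
      cobracket_eq hβ Lg.braiding_comp Le.comp_braiding hcob, whiskerRight_sub,
      Preadditive.sub_comp, insertRight_whiskerRight]
    abel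
  have hgr : g ▷ D ≫ r = mul23 r ≫ r - braid12 D ≫ mul23 r ≫ r := by
    rw [hmod]; simp [mul23, braid12]
  have hrb : mul23 b ≫ r = r ▷ D ≫ b + braid12 D ≫ mul23 r ≫ b := by
    rw [mul23, Category.assoc, hbr]; simp [mul23, braid12]
  have hrd : r ≫ d = comul23 d ≫ r ▷ D + comul23 d ≫ braid12 D ≫ mul23 r := by
    rw [hcobr]; simp [mul23, braid12, comul23]
  -- the structure maps factor through the projections in each slot
  have mb : b = D ◁ p ≫ p ▷ A ≫ brA ≫ i := by
    rw [hb, tensorHom_def'_assoc]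
  have mg : g = D ◁ q ≫ q ▷ H ≫ brH ≫ j := by
    rw [hg, tensorHom_def'_assoc]
  have mr : r = D ◁ p ≫ q ▷ A ≫ act ≫ i := by
    rw [hr, tensorHom_def'_assoc]
  have mr' : (β_ D D).hom ≫ r = D ◁ q ≫ p ▷ H ≫ (β_ A H).hom ≫ act ≫ i := by
    rw [hr, ← BraidedCategory.braiding_naturality_assoc, tensorHom_def'_assoc]
  have dq : d ≫ q ▷ D = 0 := by
    rw [hd, ← tensorHom_id, Category.assoc, Category.assoc, tensorHom_comp_tensorHom, hiq]; simp
  have dq' : d ≫ D ◁ q = 0 := by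
    rw [hd, ← id_tensorHom, Category.assoc, Category.assoc, tensorHom_comp_tensorHom, hiq]; simp
  have ep : e ≫ p ▷ D = 0 := by
    rw [he, ← tensorHom_id, Category.assoc, Category.assoc, tensorHom_comp_tensorHom, hjp]; simp
  have ep' : e ≫ D ◁ p = 0 := by
    rw [he, ← id_tensorHom, Category.assoc, Category.assoc, tensorHom_comp_tensorHom, hjp]; simp
  have fp : φ ≫ p ▷ D = 0 := by
    rw [hφ, ← tensorHom_id, Category.assoc, Category.assoc, tensorHom_comp_tensorHom, hjp]; simp
  have fq : φ ≫ D ◁ q = 0 := by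
    rw [hφ, ← id_tensorHom, Category.assoc, Category.assoc, tensorHom_comp_tensorHom, hiq]; simp
  have fq' : (φ ≫ (β_ D D).hom) ≫ q ▷ D = 0 := by
    rw [Category.assoc, ← BraidedCategory.braiding_naturality_right, reassoc_of% fq, zero_comp]
  have fp' : (φ ≫ (β_ D D).hom) ≫ D ◁ p = 0 := by
    rw [Category.assoc, ← BraidedCategory.braiding_naturality_left, reassoc_of% fp, zero_comp]
  have bq : b ≫ q = 0 := by simp [hb, hiq]
  have gp : g ≫ p = 0 := by simp [hg, hjp]
  have rq : r ≫ q = 0 := by simp [hr, hiq]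
  have left_zero : ∀ {X : 𝓒} {m : D ⊗ D ⟶ D} {a : D ⟶ X} (n : X ⊗ D ⟶ D), m ≫ a = 0 →
      m ▷ D ≫ a ▷ D ≫ n = 0 := fun n h => by rw [← comp_whiskerRight_assoc, h]; simp
  have gL : g = q ▷ D ≫ H ◁ q ≫ brH ≫ j := by rw [hg, MonoidalCategory.tensorHom_def_assoc]
  have bL : b = p ▷ D ≫ A ◁ p ≫ brA ≫ i := by rw [hb, MonoidalCategory.tensorHom_def_assoc]
  have rL : r = q ▷ D ≫ H ◁ p ≫ act ≫ i := by rw [hr, MonoidalCategory.tensorHom_def_assoc]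
  refine ⟨⟨symmetricOn_singleton hβ, antisymm_of_split hβ Lb.braiding_comp Lg.braiding_comp, ?_⟩,
    ⟨symmetricOn_singleton hβ, coantisymm_of_split hβ Ld.comp_braiding Le.comp_braiding, ?_⟩, ?_⟩
  · refine bisum_jacobi hβ Lb Lg hgr hrb ?_ ?_ ?_ ?_ ?_ ?_
    · rw [gL]; exact left_zero _ bq
    · rw [bL]; exact left_zero _ gp
    · rw [gL]; exact left_zero _ rq
    · rw [rL]; exact left_zero _ bq
    · rw [mr, mul23, Category.assoc, ← whiskerLeft_comp_assoc, gp]; simp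
    · nth_rw 2 [rL]; exact left_zero _ rq
  · refine bisum_cojacobi hβ Ld Le hφe hφd ?_ ?_ ?_ ?_ ?_ ?_
    · rw [he]; simp [reassoc_of% dq]
    · rw [hd]; simp [reassoc_of% ep]
    · rw [hφ]; simp [reassoc_of% ep]
    · nth_rw 2 [hφ]; simp [reassoc_of% fp]
    · rw [hd]; simp [reassoc_of% fp]
    · rw [he, comul23]; simp [reassoc_of% fq]
  · have s1 : braid12 D ≫ r ▷ D = ((β_ D D).hom ≫ r) ▷ D := braid12_mul12 r
    have s2 := braid23_mul23 r
    have s3 := comul23_braid23 φ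
    refine bisum_cocycle hβ Lb.braiding_comp Le.comp_braiding hcoc hslb hrd hbφ hrφ
      ?_ ?_ ?_ ?_ ?_ ?_ ?_ ?_ ?_ ?_ ?_ ?_ ?_ ?_ ?_ ?_ ?_ ?_ ?_ ?_
    · rw [he, reassoc_of% bq, zero_comp]
    · rw [hd, reassoc_of% gp, zero_comp]
    · rw [hφ, reassoc_of% gp, zero_comp]
    · rw [he, reassoc_of% rq, zero_comp]
    · exact comul23_mul12_eq_zero _ _ dq mg
    · exact comul23_braid12_mul23_eq_zero _ _ dq' mg
    · rw [s1]; exact comul23_mul12_eq_zero _ _ dq mr'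
    · rw [s2]; exact comul23_braid12_mul23_eq_zero _ _ dq' mr'
    · exact comul23_mul12_eq_zero _ _ ep mb
    · exact comul23_braid12_mul23_eq_zero _ _ ep' mb
    · exact comul23_mul12_eq_zero _ _ ep mr
    · exact comul23_braid12_mul23_eq_zero _ _ ep' mr
    · exact comul23_mul12_eq_zero _ _ fp mb
    · rw [reassoc_of% s3]; exact comul23_braid12_mul23_eq_zero _ _ fp' mb
    · exact comul23_braid12_mul23_eq_zero _ _ fq mg
    · rw [reassoc_of% s3]; exact comul23_mul12_eq_zero _ _ fq' mg
    · exact comul23_mul12_eq_zero _ _ fp mr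
    · rw [s2]; exact comul23_braid12_mul23_eq_zero _ _ fq mr'
    · rw [reassoc_of% s3, s1]; exact comul23_mul12_eq_zero _ _ fq' mr'
    · rw [reassoc_of% s3]; exact comul23_braid12_mul23_eq_zero _ _ fp' mr

end Main

end BraidedLie

theorem corollary2p2 {𝓒 : Type u} [Category.{v} 𝓒] [MonoidalCategory 𝓒]
    [BraidedCategory 𝓒] [Preadditive 𝓒] [MonoidalPreadditive 𝓒] [HasZeroObject 𝓒] [HasBinaryBiproducts 𝓒]
    (A H : 𝓒) (hsymm : BraidedLie.SymmetricOn ({A, H} : Set 𝓒))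
    (brH : H ⊗ H ⟶ H) (δH : H ⟶ H ⊗ H) (R : 𝟙_ 𝓒 ⟶ H ⊗ H)
    (hH : BraidedLie.IsQuasitriangular H brH δH R)
    (brA : A ⊗ A ⟶ A) (δA : A ⟶ A ⊗ A) (act : H ⊗ A ⟶ A)
    (hA : BraidedLie.IsModuleLieAlgebra brH brA act)
    (hA' : BraidedLie.IsModuleLieCoalgebra brH δA act)
    (hSLB : BraidedLie.SLB brA δA act (BraidedLie.coactionOfR R act)) :
    BraidedLie.IsLieBialgebra (A ⊞ H) (BraidedLie.bisumBracket brA brH act)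
      (BraidedLie.bisumCobracket δA δH (BraidedLie.coactionOfR R act)) := by
  have h := BraidedLie.isLieBialgebra_of_split hsymm hH hA hA' hSLB biprod.fst biprod.snd
    biprod.inl biprod.inr (by simp) (by simp) (by simp) (by simp) biprod.total rfl rfl rfl
    rfl rfl rfl
  -- Naturality of the braiding identifies the terms with C_{A,H} and C_{H,A} in the bisum with
  -- those using the braiding of D.
  convert! h using 1
  · simp [BraidedLie.bisumBracket]
  · simp [BraidedLie.bisumCobracket]
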